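/- Let $E^3=\mathbb{R}^3$ be Euclidean 3-space with coordinates $(x,y,z)$. A *fibration of $E^3$ by straight lines* is a set $\mathcal{F}$ of straight lines in $E^3$ that is the set of fibers of a locally trivial fiber bundle $\pi:E^3\to B$ over a surface $B$ (a two-dimensional Hausdorff second countable manifold without boundary) with fiber model $\mathbb{R}$, where $B$, $\pi$, the local trivializations and their inverses are of class $C^r$. Here $r\in\{0,1,2,\dots,\infty,\omega\}$ is fixed but arbitrary ($r=0$: topological; $r=\infty$: smooth; $r=\omega$: real-analytic). Such a fibration is *fiberwise homogeneous* if for any two fibers $\ell_1,\ell_2\in\mathcal{F}$ there is an isometry $T$ of $E^3$ onto itself that takes every fiber of $\mathcal{F}$ to a fiber of $\mathcal{F}$ and satisfies $T(\ell_1)=\ell_2$. Two sets $\mathcal{F}_1,\mathcal{F}_2$ of lines are *equivalent* if $\mathcal{F}_2=T(\mathcal{F}_1)=\{T(\ell):\ell\in\mathcal{F}_1\}$ for some isometry $T$ of $E^3$ onto itself. For $t\in\mathbb{R}$ let $\mathcal{F}_t$ be the set of images of the maximal integral curves of the vector field $$v_t=\cos(tz)\,\frac{\partial}{\partial x}+\sin(tz)\,\frac{\partial}{\partial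 y}.$$ **Theorem.** The fiberwise homogeneous fibrations of Euclidean 3-space by straight lines, up to equivalence, are precisely the $\mathcal{F}_t$ with $t\ge 0$. That is, for every $r$ as above: 1. for every $t\ge 0$, $\mathcal{F}_t$ is a fibration of $E^3$ by straight lines and is fiberwise homogeneous; 2. every fiberwise homogeneous fibration of $E^3$ by straight lines is equivalent to $\mathcal{F}_t$ for some $t\ge 0$; 3. if $t,t'\ge 0$ and $\mathcal{F}_t$ is equivalent to $\mathcal{F}_{t'}$, then $t=t'$. -/

import Mathlib

open scoped Manifold ContDiff

/-- Euclidean 3-space; the coordinates `(x, y, z)` of `p` are `(p 0, p 1, p 2)`. -/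
abbrev E3 : Type := EuclideanSpace ℝ (Fin 3)

/-- `𝓕` is the set of fibers of a locally trivial fiber bundle of class `C^r` with total space
Euclidean 3-space and one-dimensional fibers diffeomorphic to `ℝ`: there are a surface `B` of class
`C^r` and a map `π : E3 → B` of class `C^r` such that every point of `B` has an open neighbourhood
over which `π` is isomorphic, in the class `C^r`, to the projection from the product with `ℝ`.
Here `r = 0` gives topological bundles, `r = ∞` smooth and `r = ω` real-analytic ones. -/
def IsFibration (r : WithTop ℕ∞) (𝓕 : Set (Set E3)) : Prop :=
  ∃ (B : Type) (_ : TopologicalSpace B) (_ : T2Space B) (_ : SecondCountableTopology B)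
    (_ : ChartedSpace (EuclideanSpace ℝ (Fin 2)) B) (_ : IsManifold (𝓡 2) r B) (π : E3 → B),
    ContMDiff 𝓘(ℝ, E3) (𝓡 2) r π ∧
    (∀ b : B, ∃ e : Bundle.Trivialization ℝ π, b ∈ e.baseSet ∧
      ContMDiffOn 𝓘(ℝ, E3) ((𝓡 2).prod 𝓘(ℝ, ℝ)) r e e.source ∧
      ContMDiffOn ((𝓡 2).prod 𝓘(ℝ, ℝ)) 𝓘(ℝ, E3) r e.toOpenPartialHomeomorph.symm e.target) ∧
    𝓕 = Set.range fun b : B => π ⁻¹' {b}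

/-- A straight line in Euclidean 3-space. -/
def IsStraightLine (l : Set E3) : Prop :=
  ∃ p v : E3, v ≠ 0 ∧ l = Set.range fun s : ℝ => p + s • v

/-- A fibration of Euclidean 3-space by straight lines, given as its set of fibers. -/
def IsFibrationByLines (r : WithTop ℕ∞) (𝓕 : Set (Set E3)) : Prop :=
  IsFibration r 𝓕 ∧ ∀ l ∈ 𝓕, IsStraightLine l

/-- For any two fibers some isometry of the space onto itself takes fibers to fibers and takes the
first given fiber to the second. -/
def FiberwiseHomogeneous (𝓕 : Set (Set E3)) : Prop :=
  ∀ l₁ ∈ 𝓕, ∀ l₂ ∈ 𝓕, ∃ T : E3 ≃ᵢ E3, (∀ l ∈ 𝓕, T '' l ∈ 𝓕) ∧ T '' l₁ = l₂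

/-- Two fibrations are equivalent if an isometry `T` of the space onto itself carries the first to
the second, `𝓕₂ = T(𝓕₁)`. -/
def FibrationEquivalent (𝓕₁ 𝓕₂ : Set (Set E3)) : Prop :=
  ∃ T : E3 ≃ᵢ E3, 𝓕₂ = (fun l : Set E3 => T '' l) '' 𝓕₁

/-- The vector field `cos(tz) ∂x + sin(tz) ∂y`. -/
noncomputable def fieldV (t : ℝ) (p : E3) : E3 :=
  !₂[Real.cos (t * p 2), Real.sin (t * p 2), 0]

/-- `F_t`: the set of (images of) maximal integral curves of `cos(tz) ∂x + sin(tz) ∂y`; all of them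
are defined on the whole real line. -/
def fibrationF (t : ℝ) : Set (Set E3) :=
  {l | ∃ γ : ℝ → E3, IsIntegralCurve γ (fun _ => fieldV t) ∧ l = Set.range γ}

/-! The classification uses only that the projection `π` is continuous, has a Hausdorff base and has
lines as fibers. The isometries mapping fibers to fibers then form a closed group of affine maps
(`symGroup`), transitive on fibers. Cartan's argument gives it a Lie algebra of fields p ↦ w × p +
v, and a closed group with zero Lie algebra is countable
(`ClosedLinearGroup.exists_ne_zero_mem_tangent`). Countably many lines, or countably many planes, do
not fill space, so infinitesimal symmetries abound.

A field that vanishes at a point forces the fiber there to be parallel to w (`IsInf.cross_eq_zero`).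
The cases are sorted by the rotation parts w. If they are not all parallel, they fill space. Without
translations all fields would vanish at a common point, whose fiber would be parallel to every w,
which is absurd. With one translation, all translations occur and the fibers are parallel. If they
are parallel and not all zero, a rotation makes its axis a fiber, and homogeneity makes all fibers
parallel to it. A translation oblique to w yields two independent translations. A lone screw motion
would have an invariant axis meeting all fibers at one angle, which is impossible
(`false_of_fibers_meet_axis`). If they are all zero, countability arguments produce two independent
translations.

Two independent translations reduce the problem to a plane of translations (`isModel_of_plane`).
Either the fibers are parallel, or they are horizontal and a further uncountability argument gives a
screw motion across the plane, whose orbit of one fiber is the model.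

The parameter t is recovered from the vertical distance between perpendicular fibers
(`le_of_fibrationEquivalent`). -/

/-! ### Closed linear groups and their Lie algebras -/

section ClosedLinearGroups

open Filter Topology NormedSpace

variable {𝔸 : Type*} [NormedRing 𝔸]

/-- Telescoping. With M = exp(Cτ) and kτ ≤ t the factor M ^ k stays bounded, so an o(τ) difference
of the bases survives k ~ t/τ multiplications. -/
theorem norm_pow_sub_pow_le [NormOneClass 𝔸] {a b : 𝔸} {M : ℝ} (hM : 1 ≤ M) (ha : ‖a‖ ≤ M)
    (hb : ‖b‖ ≤ M) (k : ℕ) : ‖a ^ k - b ^ k‖ ≤ k * M ^ k * ‖a - b‖ := by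
  induction k with
  | zero => simp
  | succ k ih =>
    have h1 : a ^ (k + 1) - b ^ (k + 1) = a ^ k * (a - b) + (a ^ k - b ^ k) * b := by
      simp only [pow_succ]; noncomm_ring
    have h2 : ‖a ^ k‖ ≤ M ^ k := (norm_pow_le a k).trans (pow_le_pow_left₀ (norm_nonneg _) ha k)
    have hMk : 0 ≤ M ^ k := by positivity
    have h3 : ‖a ^ k * (a - b)‖ ≤ M ^ k * ‖a - b‖ :=
      (norm_mul_le _ _).trans (mul_le_mul_of_nonneg_right h2 (norm_nonneg _))
    have h4 : ‖(a ^ k - b ^ k) * b‖ ≤ (k * M ^ k * ‖a - b‖) * M :=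
      (norm_mul_le _ _).trans (mul_le_mul ih hb (norm_nonneg _) (by positivity))
    have h5 : M ^ k * ‖a - b‖ ≤ M ^ k * ‖a - b‖ * M :=
      le_mul_of_one_le_right (by positivity) hM
    calc ‖a ^ (k + 1) - b ^ (k + 1)‖ ≤ M ^ k * ‖a - b‖ + (k * M ^ k * ‖a - b‖) * M := by
          rw [h1]; exact (norm_add_le _ _).trans (add_le_add h3 h4)
      _ ≤ M ^ k * ‖a - b‖ * M + (k * M ^ k * ‖a - b‖) * M := by linarith
      _ = _ := by push_cast; ring

variable [NormedAlgebra ℝ 𝔸]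

theorem exp_zero_smul_real (X : 𝔸) : exp ((0 : ℝ) • X) = 1 := by
  rw [zero_smul, exp_zero]

/-- The one-parameter group generated by `X`. -/
noncomputable def flow (X : 𝔸) (t : ℝ) : 𝔸 := exp (t • X)

@[simp] theorem flow_zero (X : 𝔸) : flow X 0 = 1 := exp_zero_smul_real X

variable [CompleteSpace 𝔸]

theorem continuous_exp_real : Continuous (exp : 𝔸 → 𝔸) :=
  let := NormedAlgebra.restrictScalars ℚ ℝ 𝔸
  exp_continuous

theorem exp_add_smul_real (s t : ℝ) (X : 𝔸) :
    exp ((s + t) • X) = exp (s • X) * exp (t • X) := by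
  let := NormedAlgebra.restrictScalars ℚ ℝ 𝔸
  rw [add_smul]
  exact exp_add_of_commute (((Commute.refl X).smul_left s).smul_right t)

theorem exp_smul_mul_exp_neg_smul (t : ℝ) (X : 𝔸) : exp (t • X) * exp (-(t • X)) = 1 := by
  rw [← neg_smul, ← exp_add_smul_real, add_neg_cancel, zero_smul, exp_zero]

theorem exp_neg_smul_mul_exp_smul (t : ℝ) (X : 𝔸) : exp (-(t • X)) * exp (t • X) = 1 := by
  rw [← neg_smul, ← exp_add_smul_real, neg_add_cancel, zero_smul, exp_zero]

theorem exp_nat_smul_real (k : ℕ) (X : 𝔸) : exp ((k : ℝ) • X) = exp X ^ k := by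
  let := NormedAlgebra.restrictScalars ℚ ℝ 𝔸
  rw [← exp_nsmul, Nat.cast_smul_eq_nsmul]

theorem hasDerivAt_exp_smul_zero (X : 𝔸) : HasDerivAt (fun t : ℝ => exp (t • X)) X 0 := by
  simpa using hasDerivAt_exp_smul_const (𝕂 := ℝ) X 0

theorem tendsto_inv_smul_exp_sub_one {τ : ℕ → ℝ} (hτ : ∀ n, 0 < τ n)
    (hτ0 : Tendsto τ atTop (𝓝 0)) (X : 𝔸) :
    Tendsto (fun n => (τ n)⁻¹ • (exp (τ n • X) - 1)) atTop (𝓝 X) := by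
  have h2 := (hasDerivAt_exp_smul_zero X).tendsto_slope_zero
  have h3 : Tendsto τ atTop (𝓝[≠] 0) :=
    tendsto_nhdsWithin_iff.2 ⟨hτ0, Eventually.of_forall fun n => (hτ n).ne'⟩
  simpa [Function.comp_def] using h2.comp h3

/-- The key step of Cartan's closed subgroup theorem. -/
theorem exp_smul_mem_of_tendsto [NormOneClass 𝔸] (G : Submonoid 𝔸) (hG : IsClosed (G : Set 𝔸))
    {g : ℕ → 𝔸} {τ : ℕ → ℝ} (hg : ∀ n, g n ∈ G) (hτ : ∀ n, 0 < τ n)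
    (hτ0 : Tendsto τ atTop (𝓝 0)) {X : 𝔸}
    (h : Tendsto (fun n => (τ n)⁻¹ • (g n - 1)) atTop (𝓝 X)) {t : ℝ} (ht : 0 ≤ t) :
    exp (t • X) ∈ G := by
  -- With k n steps of length τ n the time t is reached up to an error below τ n. The powers of g n
  -- are compared with those of exp(τ n • X), which tend to exp(t • X).
  set k : ℕ → ℕ := fun n => ⌊t / τ n⌋₊
  set b : ℕ → 𝔸 := fun n => exp (τ n • X)
  have hY := tendsto_inv_smul_exp_sub_one hτ hτ0 X
  have hkt : ∀ n, k n * τ n ≤ t := fun n => by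
    have := Nat.floor_le (div_nonneg ht (hτ n).le)
    rwa [le_div_iff₀ (hτ n)] at this
  have hkt' : ∀ n, t - τ n ≤ k n * τ n := fun n => by
    have := Nat.lt_floor_add_one (t / τ n)
    rw [div_lt_iff₀ (hτ n)] at this
    simp only [k]
    linarith
  have hlim : Tendsto (fun n => (k n : ℝ) * τ n) atTop (𝓝 t) := by
    refine tendsto_of_tendsto_of_tendsto_of_le_of_le (g := fun n => t - τ n) (h := fun _ => t)
      ?_ tendsto_const_nhds hkt' hkt
    simpa using tendsto_const_nhds.sub hτ0
  have hb : Tendsto (fun n => b n ^ k n) atTop (𝓝 (exp (t • X))) := by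
    have : (fun n => b n ^ k n) = fun n => exp (((k n : ℝ) * τ n) • X) := by
      funext n
      rw [mul_smul, exp_nat_smul_real]
    rw [this]
    exact (continuous_exp_real.tendsto _).comp (hlim.smul_const X)
  -- Any C > ‖X‖ serves: both bases eventually have norm at most 1 + Cτ ≤ exp(Cτ).
  set C := ‖X‖ + 1
  have hCpos : 0 ≤ C := by positivity
  have bound : ∀ {x : ℕ → 𝔸}, Tendsto (fun n => (τ n)⁻¹ • (x n - 1)) atTop (𝓝 X) →
      ∀ᶠ n in atTop, ‖x n‖ ≤ Real.exp (C * τ n) := by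
    intro x hx
    have h1 : ∀ᶠ n in atTop, ‖(τ n)⁻¹ • (x n - 1)‖ < C :=
      hx.norm.eventually_lt_const (by simp [C])
    filter_upwards [h1] with n hn
    rw [norm_smul, norm_inv, Real.norm_of_nonneg (hτ n).le, inv_mul_lt_iff₀ (hτ n)] at hn
    have : ‖x n‖ ≤ ‖x n - 1‖ + 1 := by
      simpa using norm_add_le (x n - 1) 1
    have := Real.add_one_le_exp (C * τ n)
    linarith
  have hd : Tendsto (fun n => g n ^ k n - b n ^ k n) atTop (𝓝 0) := by
    have hz : Tendsto (fun n => t * Real.exp (C * t) *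
        ‖(τ n)⁻¹ • (g n - 1) - (τ n)⁻¹ • (b n - 1)‖) atTop (𝓝 0) := by
      have := ((h.sub hY).norm).const_mul (t * Real.exp (C * t))
      simpa using this
    refine squeeze_zero_norm' ?_ hz
    filter_upwards [bound h, bound hY] with n h1 h2
    have hM : 1 ≤ Real.exp (C * τ n) := Real.one_le_exp (mul_nonneg hCpos (hτ n).le)
    refine (norm_pow_sub_pow_le hM h1 h2 (k n)).trans ?_
    have e1 : (Real.exp (C * τ n)) ^ k n ≤ Real.exp (C * t) := by
      rw [← Real.exp_nat_mul, Real.exp_le_exp]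
      have := mul_le_mul_of_nonneg_left (hkt n) hCpos
      linarith
    have e2 : ‖g n - b n‖ = τ n * ‖(τ n)⁻¹ • (g n - 1) - (τ n)⁻¹ • (b n - 1)‖ := by
      rw [← smul_sub, norm_smul, norm_inv, Real.norm_of_nonneg (hτ n).le,
        mul_inv_cancel_left₀ (hτ n).ne']
      simp
    rw [e2]
    set N := ‖(τ n)⁻¹ • (g n - 1) - (τ n)⁻¹ • (b n - 1)‖
    have hN : 0 ≤ N := norm_nonneg _
    calc (k n : ℝ) * Real.exp (C * τ n) ^ k n * (τ n * N)
        = (k n * τ n) * Real.exp (C * τ n) ^ k n * N := by ring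
      _ ≤ t * Real.exp (C * t) * N := by
        gcongr
        exact hkt n
  have hgl : Tendsto (fun n => g n ^ k n) atTop (𝓝 (exp (t • X))) := by
    simpa using hd.add hb
  exact hG.mem_of_tendsto hgl (Eventually.of_forall fun n => G.pow_mem (hg n) _)

theorem flow_mul_flow_neg (X : 𝔸) (t : ℝ) : flow X t * flow (-X) t = 1 := by
  rw [flow, flow, smul_neg, exp_smul_mul_exp_neg_smul]

theorem hasDerivAt_flow (X : 𝔸) (t : ℝ) : HasDerivAt (flow X) (flow X t * X) t :=
  hasDerivAt_exp_smul_const (𝕂 := ℝ) X t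

theorem hasDerivAt_flow_zero (X : 𝔸) : HasDerivAt (flow X) X 0 :=
  hasDerivAt_exp_smul_zero X

/-- A closed submonoid of a normed algebra all of whose elements are invertible inside it. -/
structure ClosedLinearGroup (𝔸 : Type*) [NormedRing 𝔸] extends Submonoid 𝔸 where
  isClosed' : IsClosed carrier
  exists_inv' : ∀ g ∈ carrier, ∃ h ∈ carrier, g * h = 1 ∧ h * g = 1

namespace ClosedLinearGroup

theorem neg_exp_mem (G : ClosedLinearGroup 𝔸) {t : ℝ} {X : 𝔸}
    (h : exp (t • X) ∈ G.toSubmonoid) : exp ((-t) • X) ∈ G.toSubmonoid := by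
  obtain ⟨y, hy, h1, h2⟩ := G.exists_inv' _ h
  have : exp ((-t) • X) = y := by
    rw [neg_smul]
    exact (left_inv_eq_right_inv (exp_neg_smul_mul_exp_smul t X) h1)
  rwa [this]

variable [NormOneClass 𝔸]

theorem exp_mem_of_tendsto (G : ClosedLinearGroup 𝔸) {g : ℕ → 𝔸} {τ : ℕ → ℝ}
    (hg : ∀ n, g n ∈ G.toSubmonoid) (hτ : ∀ n, 0 < τ n) (hτ0 : Tendsto τ atTop (𝓝 0)) {X : 𝔸}
    (h : Tendsto (fun n => (τ n)⁻¹ • (g n - 1)) atTop (𝓝 X)) (t : ℝ) :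
    exp (t • X) ∈ G.toSubmonoid := by
  rcases le_total 0 t with ht | ht
  · exact exp_smul_mem_of_tendsto _ G.isClosed' hg hτ hτ0 h ht
  · simpa using G.neg_exp_mem
      (exp_smul_mem_of_tendsto _ G.isClosed' hg hτ hτ0 h (neg_nonneg.2 ht))

theorem exp_mem_of_hasDerivAt (G : ClosedLinearGroup 𝔸) {c : ℝ → 𝔸}
    (hc : ∀ t, c t ∈ G.toSubmonoid) (h0 : c 0 = 1) {X : 𝔸} (h : HasDerivAt c X 0) (t : ℝ) :
    exp (t • X) ∈ G.toSubmonoid := by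
  have hτ : ∀ n : ℕ, (0 : ℝ) < 1 / ((n : ℝ) + 1) := fun n => by positivity
  refine G.exp_mem_of_tendsto (fun n => hc (1 / ((n : ℝ) + 1))) hτ
    tendsto_one_div_add_atTop_nhds_zero_nat ?_ t
  have h3 : Tendsto (fun n : ℕ => 1 / ((n : ℝ) + 1)) atTop (𝓝[≠] 0) :=
    tendsto_nhdsWithin_iff.2
      ⟨tendsto_one_div_add_atTop_nhds_zero_nat, Eventually.of_forall fun n => (hτ n).ne'⟩
  have := h.tendsto_slope_zero.comp h3
  simpa [Function.comp_def, h0] using this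

/-- The Lie algebra of a closed linear group. -/
def tangent (G : ClosedLinearGroup 𝔸) : Submodule ℝ 𝔸 where
  carrier := {X | ∀ t : ℝ, exp (t • X) ∈ G.toSubmonoid}
  zero_mem' := fun t => by simp
  add_mem' := by
    intro X Y hX hY
    refine G.exp_mem_of_hasDerivAt (c := fun t => exp (t • X) * exp (t • Y))
      (fun t => G.mul_mem (hX t) (hY t)) (by simp) ?_
    simpa [Pi.mul_def] using (hasDerivAt_exp_smul_zero X).mul (hasDerivAt_exp_smul_zero Y)
  smul_mem' := by
    intro c X hX t
    rw [smul_smul]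
    exact hX _

theorem mem_tangent {G : ClosedLinearGroup 𝔸} {X : 𝔸} :
    X ∈ G.tangent ↔ ∀ t : ℝ, flow X t ∈ G.toSubmonoid := Iff.rfl

theorem isClosed_tangent (G : ClosedLinearGroup 𝔸) : IsClosed (G.tangent : Set 𝔸) := by
  have : (G.tangent : Set 𝔸) = ⋂ t : ℝ, (fun X : 𝔸 => exp (t • X)) ⁻¹' G.carrier := by
    ext X
    simp only [Set.mem_iInter]
    exact Iff.rfl
  rw [this]
  exact isClosed_iInter fun t =>
    G.isClosed'.preimage (continuous_exp_real.comp (continuous_const_smul t))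

theorem conj_mem_tangent (G : ClosedLinearGroup 𝔸) {g h X : 𝔸} (hg : g ∈ G.toSubmonoid)
    (hh : h ∈ G.toSubmonoid) (h1 : g * h = 1) (h2 : h * g = 1) (hX : X ∈ G.tangent) :
    g * X * h ∈ G.tangent := by
  intro t
  let := NormedAlgebra.restrictScalars ℚ ℝ 𝔸
  let y : 𝔸ˣ := ⟨g, h, h1, h2⟩
  have : t • (g * X * h) = y * (t • X) * ↑y⁻¹ := by
    change _ = g * (t • X) * h
    rw [mul_smul_comm, smul_mul_assoc]
  rw [this, exp_units_conj]
  exact G.mul_mem (G.mul_mem hg (hX t)) hh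

/-- The bracket is the velocity at t = 0 of the conjugates of Y by exp(tX), a curve in the closed
subspace `tangent`. -/
theorem bracket_mem_tangent (G : ClosedLinearGroup 𝔸) {X Y : 𝔸} (hX : X ∈ G.tangent)
    (hY : Y ∈ G.tangent) : X * Y - Y * X ∈ G.tangent := by
  have hc : ∀ t : ℝ, exp (t • X) * Y * exp (t • (-X)) ∈ G.tangent := fun t => by
    refine G.conj_mem_tangent (hX t) (G.tangent.neg_mem hX t) ?_ ?_ hY
    · rw [smul_neg, exp_smul_mul_exp_neg_smul]
    · rw [smul_neg, exp_neg_smul_mul_exp_smul]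
  have h := ((hasDerivAt_exp_smul_zero X).mul_const Y).mul (hasDerivAt_exp_smul_zero (-X))
  simp only [zero_smul, exp_zero, one_mul, mul_one, mul_neg] at h
  rw [← sub_eq_add_neg] at h
  refine G.isClosed_tangent.mem_of_tendsto h.tendsto_slope_zero (Eventually.of_forall fun t => ?_)
  exact G.tangent.smul_mem _ (G.tangent.sub_mem (hc _) (by simpa using hY))

/-- If elements g ≠ 1 accumulated at 1, the unit vectors along g - 1 would subconverge to a nonzero
tangent vector. Otherwise 1 is isolated, translation makes the group discrete, and a discrete subset
of a finite-dimensional space is countable. -/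
theorem exists_ne_zero_mem_tangent [FiniteDimensional ℝ 𝔸] (G : ClosedLinearGroup 𝔸)
    (hG : ¬ G.carrier.Countable) : ∃ X ∈ G.tangent, X ≠ 0 := by
  by_contra! hT
  have : ProperSpace 𝔸 := FiniteDimensional.proper ℝ 𝔸
  have key : ∃ ε > 0, ∀ g ∈ G.toSubmonoid, ‖g - 1‖ < ε → g = 1 := by
    by_contra! hne
    choose g hg hlt hne1 using fun n : ℕ => hne (1 / ((n : ℝ) + 1)) (by positivity)
    have hpos : ∀ n, 0 < ‖g n - 1‖ := fun n => norm_pos_iff.2 (sub_ne_zero.2 (hne1 n))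
    have hlim : Tendsto (fun n => ‖g n - 1‖) atTop (𝓝 0) :=
      squeeze_zero (fun n => norm_nonneg _) (fun n => (hlt n).le)
        tendsto_one_div_add_atTop_nhds_zero_nat
    have hs : ∀ n, ‖g n - 1‖⁻¹ • (g n - 1) ∈ Metric.sphere (0 : 𝔸) 1 := fun n => by
      simp [norm_smul, inv_mul_cancel₀ (hpos n).ne']
    obtain ⟨X, hX, φ, hφ, hφX⟩ := (isCompact_sphere (0 : 𝔸) 1).tendsto_subseq hs
    have := hT X (G.exp_mem_of_tendsto (fun n => hg (φ n)) (fun n => hpos (φ n))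
      (hlim.comp hφ.tendsto_atTop) hφX)
    simp [this] at hX
  obtain ⟨ε, hε, hiso⟩ := key
  have hdisc : DiscreteTopology G.carrier := by
    rw [discreteTopology_iff_isOpen_singleton]
    rintro ⟨a, ha⟩
    obtain ⟨a', ha', h1, h2⟩ := G.exists_inv' a ha
    rw [Metric.isOpen_singleton_iff]
    have hpos : 0 < ‖a'‖ + 1 := by positivity
    refine ⟨ε / (‖a'‖ + 1), by positivity, ?_⟩
    rintro ⟨b, hb⟩ hab
    rw [Subtype.dist_eq, dist_eq_norm, lt_div_iff₀ hpos] at hab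
    have : a' * b = 1 := by
      refine hiso _ (G.mul_mem ha' hb) ?_
      have : a' * b - 1 = a' * (b - a) := by rw [mul_sub, h2]
      rw [this]
      refine (norm_mul_le _ _).trans_lt (lt_of_le_of_lt ?_ hab)
      simp only
      nlinarith [norm_nonneg (b - a), norm_nonneg a']
    refine Subtype.ext ?_
    have := congrArg (a * ·) this
    simpa [← mul_assoc, h1] using this
  exact hG (countable_of_Lindelof_of_discrete (X := G.carrier)).to_set

end ClosedLinearGroup

end ClosedLinearGroups

/-! ### Cross product identities in Euclidean 3-space -/

section CrossProduct

/-- The cross product of `E3`. -/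
noncomputable def vcross (a b : E3) : E3 :=
  !₂[a 1 * b 2 - a 2 * b 1, a 2 * b 0 - a 0 * b 2, a 0 * b 1 - a 1 * b 0]

@[simp] theorem vcross_apply_zero (a b : E3) : vcross a b 0 = a 1 * b 2 - a 2 * b 1 := rfl
@[simp] theorem vcross_apply_one (a b : E3) : vcross a b 1 = a 2 * b 0 - a 0 * b 2 := rfl
@[simp] theorem vcross_apply_two (a b : E3) : vcross a b 2 = a 0 * b 1 - a 1 * b 0 := rfl

theorem E3.ext_coord {a b : E3} (h0 : a 0 = b 0) (h1 : a 1 = b 1) (h2 : a 2 = b 2) : a = b := by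
  ext i
  fin_cases i
  exacts [h0, h1, h2]

theorem E3.inner_eq (a b : E3) : inner ℝ a b = a 0 * b 0 + a 1 * b 1 + a 2 * b 2 := by
  simp [PiLp.inner_apply, Fin.sum_univ_three]
  ring

theorem vcross_add_right (a b c : E3) : vcross a (b + c) = vcross a b + vcross a c := by
  apply E3.ext_coord <;> simp <;> ring

theorem vcross_add_left (a b c : E3) : vcross (a + b) c = vcross a c + vcross b c := by
  apply E3.ext_coord <;> simp <;> ring

theorem vcross_smul_right (r : ℝ) (a b : E3) : vcross a (r • b) = r • vcross a b := by
  apply E3.ext_coord <;> simp <;> ring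

theorem vcross_smul_left (r : ℝ) (a b : E3) : vcross (r • a) b = r • vcross a b := by
  apply E3.ext_coord <;> simp <;> ring

theorem vcross_sub_right (a b c : E3) : vcross a (b - c) = vcross a b - vcross a c := by
  apply E3.ext_coord <;> simp <;> ring

@[simp] theorem vcross_self (a : E3) : vcross a a = 0 := by
  apply E3.ext_coord <;> simp <;> ring

@[simp] theorem vcross_zero_left (a : E3) : vcross 0 a = 0 := by
  apply E3.ext_coord <;> simp

@[simp] theorem vcross_zero_right (a : E3) : vcross a 0 = 0 := by
  apply E3.ext_coord <;> simp

theorem vcross_anticomm (a b : E3) : vcross a b = -vcross b a := by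
  apply E3.ext_coord <;> simp <;> ring

@[simp] theorem inner_cross_left (a b : E3) : inner ℝ a (vcross a b) = 0 := by
  rw [E3.inner_eq]; simp; ring

@[simp] theorem inner_cross_right (a b : E3) : inner ℝ b (vcross a b) = 0 := by
  rw [E3.inner_eq]; simp; ring

theorem vcross_cross_right (a b c : E3) :
    vcross a (vcross b c) = (inner ℝ a c : ℝ) • b - (inner ℝ a b : ℝ) • c := by
  apply E3.ext_coord <;> simp [E3.inner_eq] <;> ring

theorem vcross_cross_left (a b c : E3) :
    vcross (vcross a b) c = (inner ℝ a c : ℝ) • b - (inner ℝ b c : ℝ) • a := by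
  apply E3.ext_coord <;> simp [E3.inner_eq] <;> ring

theorem vcross_jacobi (a b c : E3) :
    vcross a (vcross b c) - vcross b (vcross a c) = vcross (vcross a b) c := by
  apply E3.ext_coord <;> simp <;> ring

theorem exists_smul_of_cross_eq_zero {a b : E3} (ha : a ≠ 0) (h : vcross a b = 0) :
    ∃ c : ℝ, b = c • a := by
  have h1 := vcross_cross_right a a b
  rw [h, vcross_zero_right] at h1
  have ha' : (inner ℝ a a : ℝ) ≠ 0 := inner_self_ne_zero.2 ha
  refine ⟨(inner ℝ a a : ℝ)⁻¹ * inner ℝ a b, ?_⟩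
  rw [mul_smul, sub_eq_zero.1 h1.symm, smul_smul, inv_mul_cancel₀ ha', one_smul]

theorem mem_span_singleton_iff_cross {a b : E3} (ha : a ≠ 0) :
    b ∈ Submodule.span ℝ {a} ↔ vcross a b = 0 := by
  rw [Submodule.mem_span_singleton]
  constructor
  · rintro ⟨c, rfl⟩
    rw [vcross_smul_right, vcross_self, smul_zero]
  · intro h
    obtain ⟨c, hc⟩ := exists_smul_of_cross_eq_zero ha h
    exact ⟨c, hc.symm⟩

theorem exists_cross_of_skew (W : E3 →ₗ[ℝ] E3) (hW : ∀ u, inner ℝ u (W u) = (0 : ℝ)) :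
    ∃ w : E3, ∀ u, W u = vcross w u := by
  have hsk : ∀ u v, inner ℝ u (W v) + inner ℝ v (W u) = (0 : ℝ) := fun u v => by
    have := hW (u + v)
    rw [map_add, inner_add_left, inner_add_right, inner_add_right, hW, hW] at this
    linarith
  set e : Fin 3 → E3 := fun i => EuclideanSpace.single i 1
  have hin : ∀ i (v : E3), inner ℝ (e i) v = v i := fun i v => by
    fin_cases i <;> simp [e, E3.inner_eq]
  have hs : ∀ i j, W (e j) i = - W (e i) j := fun i j => by
    have := hsk (e i) (e j)
    rw [hin, hin] at this
    linarith
  have hd : ∀ i, W (e i) i = 0 := fun i => by have := hs i i; linarith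
  refine ⟨!₂[W (e 1) 2, W (e 2) 0, W (e 0) 1], fun u => ?_⟩
  have hu : u = u 0 • e 0 + u 1 • e 1 + u 2 • e 2 := by
    apply E3.ext_coord <;> simp [e]
  have hWu : W u = u 0 • W (e 0) + u 1 • W (e 1) + u 2 • W (e 2) := by
    conv_lhs => rw [hu]
    simp
  rw [hWu]
  apply E3.ext_coord
  · simp [hd, hs 0 1]; ring
  · simp [hd, hs 1 2]; ring
  · simp [hd, hs 2 0]; ring

end CrossProduct

/-! ### Rigid motions as linear maps and their infinitesimal generators -/

section AffineAlgebra

open Filter Topology NormedSpace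

/-- The algebra containing the affine maps `p ↦ A p + a` of `E3`, as the linear maps
`(p, s) ↦ (A p + s a, s)`. -/
abbrev AffAlg : Type := (E3 × ℝ) →L[ℝ] (E3 × ℝ)

/-- The image of a point. -/
def pt (g : AffAlg) (p : E3) : E3 := (g (p, 1)).1

/-- The image of a vector. -/
def lin (g : AffAlg) (v : E3) : E3 := (g (v, 0)).1

/-- `g` represents an isometry of `E3`. -/
structure IsRigid (g : AffAlg) : Prop where
  snd : ∀ x, (g x).2 = x.2
  norm : ∀ v, ‖lin g v‖ = ‖v‖

theorem lin_add (g : AffAlg) (u v : E3) : lin g (u + v) = lin g u + lin g v := by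
  have : ((u + v, 0) : E3 × ℝ) = (u, 0) + (v, 0) := by simp
  simp only [lin, this, map_add, Prod.fst_add]

theorem lin_smul (g : AffAlg) (c : ℝ) (u : E3) : lin g (c • u) = c • lin g u := by
  have : ((c • u, 0) : E3 × ℝ) = c • (u, 0) := by simp
  simp only [lin, this, map_smul, Prod.smul_fst]

theorem pt_add (g : AffAlg) (p v : E3) : pt g (p + v) = pt g p + lin g v := by
  have : ((p + v, 1) : E3 × ℝ) = (p, 1) + (v, 0) := by simp
  simp only [pt, lin, this, map_add, Prod.fst_add]

theorem IsRigid.apply_pt {g : AffAlg} (hg : IsRigid g) (p : E3) : g (p, 1) = (pt g p, 1) :=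
  Prod.ext rfl (hg.snd _)

theorem IsRigid.apply_lin {g : AffAlg} (hg : IsRigid g) (v : E3) : g (v, 0) = (lin g v, 0) :=
  Prod.ext rfl (hg.snd _)

theorem pt_mul (g : AffAlg) {h : AffAlg} (hh : IsRigid h) (p : E3) :
    pt (g * h) p = pt g (pt h p) := by
  simp only [pt, mul_apply_eq_comp]
  rw [hh.apply_pt]

theorem lin_mul (g : AffAlg) {h : AffAlg} (hh : IsRigid h) (v : E3) :
    lin (g * h) v = lin g (lin h v) := by
  simp only [lin, mul_apply_eq_comp]
  rw [hh.apply_lin]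

@[simp] theorem pt_one (p : E3) : pt 1 p = p := rfl

@[simp] theorem lin_one (p : E3) : lin 1 p = p := rfl

theorem isRigid_one : IsRigid 1 := ⟨fun _ => rfl, fun _ => rfl⟩

theorem IsRigid.mul {g h : AffAlg} (hg : IsRigid g) (hh : IsRigid h) : IsRigid (g * h) :=
  ⟨fun x => by rw [mul_apply_eq_comp, hg.snd, hh.snd],
    fun v => by rw [lin_mul _ hh, hg.norm, hh.norm]⟩

theorem continuous_eval (x : E3 × ℝ) : Continuous fun g : AffAlg => g x :=
  (ContinuousLinearMap.apply ℝ (E3 × ℝ) x).continuous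

theorem continuous_pt (p : E3) : Continuous fun g : AffAlg => pt g p :=
  continuous_fst.comp (continuous_eval _)

theorem continuous_lin (p : E3) : Continuous fun g : AffAlg => lin g p :=
  continuous_fst.comp (continuous_eval _)

theorem isClosed_isRigid : IsClosed {g : AffAlg | IsRigid g} := by
  have : {g : AffAlg | IsRigid g} =
      (⋂ x, {g | (g x).2 = x.2}) ∩ ⋂ v, {g | ‖lin g v‖ = ‖v‖} := by
    ext g
    simp only [Set.mem_inter_iff, Set.mem_iInter, Set.mem_ofPred_eq]
    exact ⟨fun h => ⟨h.1, h.2⟩, fun h => ⟨h.1, h.2⟩⟩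
  rw [this]
  exact (isClosed_iInter fun x =>
    isClosed_eq (continuous_snd.comp (continuous_eval x)) continuous_const).inter
    (isClosed_iInter fun v => isClosed_eq (continuous_lin v).norm continuous_const)

/-- The linear part of a rigid map. -/
noncomputable def linIsometry {g : AffAlg} (hg : IsRigid g) : E3 →ₗᵢ[ℝ] E3 where
  toFun := lin g
  map_add' := lin_add g
  map_smul' := lin_smul g
  norm_map' := hg.norm

theorem IsRigid.inner_lin {g : AffAlg} (hg : IsRigid g) (u v : E3) :
    (inner ℝ (lin g u) (lin g v) : ℝ) = inner ℝ u v :=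
  (linIsometry hg).inner_map_map u v

theorem IsRigid.lin_ne_zero {g : AffAlg} (hg : IsRigid g) {u : E3} (hu : u ≠ 0) : lin g u ≠ 0 := by
  rw [← norm_ne_zero_iff, hg.norm, norm_ne_zero_iff]
  exact hu

theorem IsRigid.exists_inv {g : AffAlg} (hg : IsRigid g) :
    ∃ h : AffAlg, IsRigid h ∧ g * h = 1 ∧ h * g = 1 := by
  let A : E3 ≃ₗᵢ[ℝ] E3 := (linIsometry hg).toLinearIsometryEquiv rfl
  have hA : ∀ v, A v = lin g v := fun v => rfl
  let h : AffAlg := (A.symm.toContinuousLinearEquiv.toContinuousLinearMap.comp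
    (ContinuousLinearMap.fst ℝ E3 ℝ - (ContinuousLinearMap.snd ℝ E3 ℝ).smulRight (pt g 0))).prod
    (ContinuousLinearMap.snd ℝ E3 ℝ)
  have happ : ∀ v s, h (v, s) = (A.symm (v - s • pt g 0), s) := fun v s => rfl
  have gapp : ∀ v s, g (v, s) = (A v + s • pt g 0, s) := fun v s => by
    have : ((v, s) : E3 × ℝ) = (v, 0) + s • ((0 : E3), (1 : ℝ)) := by simp
    rw [this, map_add, map_smul, hg.apply_lin, hg.apply_pt]
    simp [hA]
  refine ⟨h, ⟨fun x => rfl, fun v => ?_⟩, ?_, ?_⟩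
  · simp [lin, happ]
  · refine ContinuousLinearMap.ext fun x => ?_
    rw [mul_apply_eq_comp, happ x.1 x.2, gapp]
    simp
  · refine ContinuousLinearMap.ext fun x => ?_
    rw [mul_apply_eq_comp, gapp x.1 x.2, happ]
    simp

/-- The infinitesimal rigid motion `p ↦ w × p + v`. -/
noncomputable def kil (w v : E3) : AffAlg :=
  LinearMap.toContinuousLinearMap
    { toFun := fun x => (vcross w x.1 + x.2 • v, 0)
      map_add' := fun x y => by
        ext1
        · simp only [Prod.fst_add, Prod.snd_add, vcross_add_right, add_smul]; abel
        · simp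
      map_smul' := fun c x => by
        ext1
        · simp [vcross_smul_right, mul_smul]
        · simp }

@[simp] theorem kil_apply (w v : E3) (x : E3 × ℝ) : kil w v x = (vcross w x.1 + x.2 • v, 0) := rfl

theorem affAlg_ext {g h : AffAlg} (H : ∀ p s, g (p, s) = h (p, s)) : g = h :=
  ContinuousLinearMap.ext fun x => H x.1 x.2

theorem kil_add (w v w' v' : E3) : kil w v + kil w' v' = kil (w + w') (v + v') := by
  refine affAlg_ext fun p s => Prod.ext ?_ ?_
  · simp [vcross_add_left]; abel
  · simp

theorem kil_smul (c : ℝ) (w v : E3) : c • kil w v = kil (c • w) (c • v) := by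
  refine affAlg_ext fun p s => Prod.ext ?_ ?_
  · simp [vcross_smul_left, smul_comm s c]
  · simp

theorem kil_bracket (w v w' v' : E3) : kil w v * kil w' v' - kil w' v' * kil w v =
    kil (vcross w w') (vcross w v' - vcross w' v) := by
  refine affAlg_ext fun p s => Prod.ext ?_ ?_
  · simp only [sub_apply, mul_apply_eq_comp, kil_apply,
      Prod.fst_sub, zero_smul, add_zero, vcross_add_right, vcross_smul_right, ← vcross_jacobi,
      smul_sub]
    abel
  · simp

theorem hasDerivAt_flow_apply (X : AffAlg) (x : E3 × ℝ) (t : ℝ) :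
    HasDerivAt (fun t => flow X t x) (flow X t (X x)) t := by
  have := (hasDerivAt_flow X t).clm_apply (hasDerivAt_const t x)
  simpa using this

/-- Integral curves of a linear vector field are given by the exponential. -/
theorem flow_apply_of_hasDerivAt (X : AffAlg) {γ : ℝ → E3 × ℝ}
    (hγ : ∀ t, HasDerivAt γ (X (γ t)) t) (t : ℝ) : flow X t (γ 0) = γ t := by
  have hd : ∀ t, HasDerivAt (fun t : ℝ => flow (-X) t (γ t)) 0 t := fun t => by
    have := (hasDerivAt_flow (-X) t).clm_apply (hγ t)
    simpa using this
  have hc := is_const_of_deriv_eq_zero (fun t => (hd t).differentiableAt) (fun t => (hd t).deriv) t 0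
  rw [flow_zero, one_apply_eq_self] at hc
  rw [← hc, ← mul_apply_eq_comp, flow_mul_flow_neg]
  rfl

theorem flow_kil_zero_apply (v p : E3) (s t : ℝ) :
    flow (kil 0 v) t (p, s) = (p + (t * s) • v, s) := by
  have := flow_apply_of_hasDerivAt (kil 0 v) (γ := fun t => (p + (t * s) • v, s)) (fun t => ?_) t
  · simpa using this
  · have h1 : HasDerivAt (fun t : ℝ => p + (t * s) • v) (s • v) t := by
      simpa using (((hasDerivAt_id t).mul_const s).smul_const v).const_add p
    simpa using h1.prodMk (hasDerivAt_const t s)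

theorem flow_apply_of_apply_eq_zero {X : AffAlg} {x : E3 × ℝ} (h : X x = 0) (t : ℝ) :
    flow X t x = x :=
  flow_apply_of_hasDerivAt X (γ := fun _ => x) (fun t => by rw [h]; exact hasDerivAt_const t x) t

/-- A linear condition satisfied along a one-parameter group is satisfied by its generator. -/
theorem apply_mem_of_flow_mem {E : Type*} [NormedAddCommGroup E] [NormedSpace ℝ E]
    [FiniteDimensional ℝ E] (L : AffAlg →L[ℝ] E) (S : Submodule ℝ E) {X : AffAlg}
    (h : ∀ t : ℝ, L (flow X t) - L 1 ∈ S) : L X ∈ S := by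
  have hS : IsClosed (S : Set E) := S.closed_of_finiteDimensional
  have hl : HasDerivAt (fun t : ℝ => L (flow X t)) (L X) 0 :=
    L.hasFDerivAt.comp_hasDerivAt (0 : ℝ) (hasDerivAt_flow_zero X)
  refine hS.mem_of_tendsto hl.tendsto_slope_zero (Eventually.of_forall fun t => ?_)
  refine S.smul_mem _ ?_
  simpa only [zero_add, flow_zero] using h t

/-- Evaluation of the image of a point or vector, as a linear map. -/
noncomputable def fstEval (x : E3 × ℝ) : AffAlg →L[ℝ] E3 :=
  (ContinuousLinearMap.fst ℝ E3 ℝ).comp (ContinuousLinearMap.apply ℝ (E3 × ℝ) x)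

@[simp] theorem fstEval_apply (x : E3 × ℝ) (g : AffAlg) : fstEval x g = (g x).1 := rfl

/-- Differentiating the constant ‖lin (flow X t) u‖² makes the linear part of X skew, hence a cross
product. -/
theorem exists_eq_kil {X : AffAlg} (h : ∀ t : ℝ, IsRigid (flow X t)) :
    ∃ w v, X = kil w v := by
  have hsnd : ∀ x, (X x).2 = 0 := fun x => by
    have := apply_mem_of_flow_mem ((ContinuousLinearMap.snd ℝ E3 ℝ).comp
      (ContinuousLinearMap.apply ℝ (E3 × ℝ) x)) ⊥ (X := X) (fun t => by simp [(h t).snd])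
    simpa using this
  have hskew : ∀ u, inner ℝ u (lin X u) = (0 : ℝ) := fun u => by
    have hd : HasDerivAt (fun t : ℝ => lin (flow X t) u) (lin X u) 0 := by
      have := hasDerivAt_flow_apply X (u, 0) 0
      rw [flow_zero] at this
      exact (ContinuousLinearMap.fst ℝ E3 ℝ).hasFDerivAt.comp_hasDerivAt (0 : ℝ) this
    have h1 := hd.norm_sq
    have h2 : (fun t : ℝ => ‖lin (flow X t) u‖ ^ 2) = fun _ => ‖u‖ ^ 2 := by
      funext t; rw [(h t).norm]
    rw [h2] at h1
    have := h1.unique (hasDerivAt_const _ _)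
    simpa using this
  let W : E3 →ₗ[ℝ] E3 :=
    { toFun := lin X, map_add' := lin_add X, map_smul' := lin_smul X }
  obtain ⟨w, hw⟩ := exists_cross_of_skew W hskew
  refine ⟨w, pt X 0, affAlg_ext fun p s => Prod.ext ?_ (hsnd _)⟩
  have h1 : ((p, s) : E3 × ℝ) = (p, 0) + s • ((0 : E3), (1 : ℝ)) := by simp
  rw [h1, map_add, map_smul]
  have : lin X p = vcross w p := hw p
  simp [← this, lin, pt]

end AffineAlgebra

/-! ### Line fibrations and their symmetry groups -/

section LineMaps

open Filter Topology

variable {B : Type*} {π : E3 → B}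

/-- A continuous map on `E3` all of whose fibers are straight lines. -/
structure IsLineMap [TopologicalSpace B] (π : E3 → B) : Prop where
  continuous : Continuous π
  exists_dir : ∀ p, ∃ u : E3, ‖u‖ = 1 ∧ ∀ q, π q = π p ↔ ∃ s : ℝ, q = p + s • u

/-- The line through `p` in the direction `u` lies in a fiber of `π`. -/
def IsDir (π : E3 → B) (p u : E3) : Prop := ∀ s : ℝ, π (p + s • u) = π p

theorem IsDir.smul {p u : E3} (h : IsDir π p u) (c : ℝ) : IsDir π p (c • u) := fun s => by
  rw [smul_smul]
  exact h _

namespace IsLineMap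

variable [TopologicalSpace B]

theorem exists_isDir (hπ : IsLineMap π) (p : E3) : ∃ u : E3, ‖u‖ = 1 ∧ IsDir π p u := by
  obtain ⟨u, hu, h⟩ := hπ.exists_dir p
  exact ⟨u, hu, fun s => (h _).2 ⟨s, rfl⟩⟩

theorem exists_eq_add (hπ : IsLineMap π) {p u q : E3} (hu : u ≠ 0) (h : IsDir π p u)
    (hq : π q = π p) : ∃ s : ℝ, q = p + s • u := by
  obtain ⟨v, hv, H⟩ := hπ.exists_dir p
  obtain ⟨a, ha⟩ := (H _).1 (h 1)
  obtain ⟨b, rfl⟩ := (H _).1 hq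
  rw [one_smul, add_right_inj] at ha
  have ha0 : a ≠ 0 := by
    rintro rfl
    exact hu (by rw [ha, zero_smul])
  exact ⟨b * a⁻¹, by rw [ha, smul_smul, inv_mul_cancel_right₀ ha0]⟩

theorem exists_smul_of_isDir (hπ : IsLineMap π) {p u u' : E3} (hu : u ≠ 0) (h : IsDir π p u)
    (h' : IsDir π p u') : ∃ c : ℝ, u' = c • u := by
  obtain ⟨s, hs⟩ := hπ.exists_eq_add hu h (h' 1)
  rw [one_smul, add_right_inj] at hs
  exact ⟨s, hs⟩

theorem isDir_of_eq (hπ : IsLineMap π) {p u q : E3} (h : IsDir π p u) (hq : π q = π p) :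
    IsDir π q u := by
  rcases eq_or_ne u 0 with rfl | hu
  · intro s; simp
  · obtain ⟨s, rfl⟩ := hπ.exists_eq_add hu h hq
    intro r
    rw [add_assoc, ← add_smul, h, h]

end IsLineMap

/-- Cutting a closed linear group by a closed condition that defines a subgroup. -/
def ClosedLinearGroup.cut {𝔸 : Type*} [NormedRing 𝔸] (G : ClosedLinearGroup 𝔸) (P : 𝔸 → Prop)
    (hP : IsClosed {g | P g}) (h1 : P 1)
    (hmul : ∀ g ∈ G.toSubmonoid, ∀ h ∈ G.toSubmonoid, P g → P h → P (g * h))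
    (hinv : ∀ g ∈ G.toSubmonoid, ∀ h ∈ G.toSubmonoid, g * h = 1 → P g → P h) :
    ClosedLinearGroup 𝔸 where
  carrier := G.carrier ∩ {g | P g}
  one_mem' := ⟨G.one_mem, h1⟩
  mul_mem' := fun {g h} hg hh => ⟨G.mul_mem hg.1 hh.1, hmul g hg.1 h hh.1 hg.2 hh.2⟩
  isClosed' := G.isClosed'.inter hP
  exists_inv' := fun g hg => by
    obtain ⟨h, hh, h1, h2⟩ := G.exists_inv' g hg.1
    exact ⟨h, ⟨hh, hinv g hg.1 h hh h1 hg.2⟩, h1, h2⟩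

variable [TopologicalSpace B] [T2Space B]

/-- The group of isometries of `E3` that map fibers of `π` to fibers of `π`. -/
def symGroup (hπ : IsLineMap π) : ClosedLinearGroup AffAlg where
  carrier := {g | IsRigid g ∧ ∀ p q, π p = π q → π (pt g p) = π (pt g q)}
  one_mem' := ⟨isRigid_one, fun _ _ h => h⟩
  mul_mem' := fun {g h} hg hh => ⟨hg.1.mul hh.1, fun p q hpq => by
    rw [pt_mul _ hh.1, pt_mul _ hh.1]
    exact hg.2 _ _ (hh.2 _ _ hpq)⟩
  isClosed' := by
    have : {g : AffAlg | IsRigid g ∧ ∀ p q, π p = π q → π (pt g p) = π (pt g q)} =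
        {g | IsRigid g} ∩ ⋂ p, ⋂ q, ⋂ (_ : π p = π q), {g | π (pt g p) = π (pt g q)} := by
      ext g
      simp
    rw [this]
    refine isClosed_isRigid.inter (isClosed_iInter fun p => isClosed_iInter fun q =>
      isClosed_iInter fun _ => ?_)
    exact isClosed_eq (hπ.continuous.comp (continuous_pt p)) (hπ.continuous.comp (continuous_pt q))
  exists_inv' := by
    rintro g ⟨hg, hgπ⟩
    obtain ⟨h, hh, h1, h2⟩ := hg.exists_inv
    refine ⟨h, ⟨hh, fun p q hpq => ?_⟩, h1, h2⟩
    -- Only g is known to respect fibers. It sends the whole line through h p to a line inside the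
    -- fiber of p, which must be all of that fiber; so h respects fibers too.
    obtain ⟨u, hu, hd⟩ := hπ.exists_isDir (pt h p)
    have hu0 : u ≠ 0 := by rw [← norm_ne_zero_iff, hu]; exact one_ne_zero
    have hgh : ∀ x, pt g (pt h x) = x := fun x => by rw [← pt_mul _ hh, h1, pt_one]
    have hhg : ∀ x, lin h (lin g x) = x := fun x => by rw [← lin_mul _ hg, h2, lin_one]
    have hd' : IsDir π p (lin g u) := fun s => by
      have := hgπ _ _ (hd s)
      rwa [pt_add, lin_smul, hgh] at this
    obtain ⟨s, rfl⟩ := hπ.exists_eq_add (hg.lin_ne_zero hu0) hd' hpq.symm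
    rw [pt_add, lin_smul, hhg, hd s]

variable {hπ : IsLineMap π}

theorem isRigid_of_mem {g : AffAlg} (hg : g ∈ (symGroup hπ).toSubmonoid) : IsRigid g := hg.1

theorem map_fiber_of_mem {g : AffAlg} (hg : g ∈ (symGroup hπ).toSubmonoid) {p q : E3}
    (h : π p = π q) : π (pt g p) = π (pt g q) := hg.2 _ _ h

theorem IsDir.map {g : AffAlg} (hg : g ∈ (symGroup hπ).toSubmonoid) {p u : E3}
    (h : IsDir π p u) : IsDir π (pt g p) (lin g u) := fun s => by
  rw [← lin_smul, ← pt_add]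
  exact map_fiber_of_mem hg (h s)

/-- `p ↦ w × p + v` is an infinitesimal symmetry of the fibers of `π`. -/
def IsInf (hπ : IsLineMap π) (w v : E3) : Prop := kil w v ∈ (symGroup hπ).tangent

theorem exists_isInf {G : ClosedLinearGroup AffAlg} (hG : G.carrier ⊆ (symGroup hπ).carrier)
    {X : AffAlg} (hX : X ∈ G.tangent) : ∃ w v, X = kil w v ∧ IsInf hπ w v := by
  obtain ⟨w, v, rfl⟩ := exists_eq_kil (X := X) fun t =>
    (hG (ClosedLinearGroup.mem_tangent.1 hX t)).1
  exact ⟨w, v, rfl, ClosedLinearGroup.mem_tangent.2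
    fun t => hG (ClosedLinearGroup.mem_tangent.1 hX t)⟩

theorem IsInf.flow_mem {w v : E3} (h : IsInf hπ w v) (t : ℝ) :
    flow (kil w v) t ∈ (symGroup hπ).toSubmonoid := ClosedLinearGroup.mem_tangent.1 h t

theorem IsInf.add {w v w' v' : E3} (h : IsInf hπ w v) (h' : IsInf hπ w' v') :
    IsInf hπ (w + w') (v + v') := by
  rw [IsInf, ← kil_add]
  exact Submodule.add_mem _ h h'

theorem IsInf.smul {w v : E3} (h : IsInf hπ w v) (c : ℝ) : IsInf hπ (c • w) (c • v) := by
  rw [IsInf, ← kil_smul]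
  exact Submodule.smul_mem _ c h

theorem IsInf.bracket {w v w' v' : E3} (h : IsInf hπ w v) (h' : IsInf hπ w' v') :
    IsInf hπ (vcross w w') (vcross w v' - vcross w' v) := by
  rw [IsInf, ← kil_bracket]
  exact ClosedLinearGroup.bracket_mem_tangent _ h h'

theorem IsInf.bracket_zero {w v v' : E3} (h : IsInf hπ w v) (h' : IsInf hπ 0 v') :
    IsInf hπ 0 (vcross w v') := by
  simpa using h.bracket h'

theorem IsInf.sub_zero_left {w v v' : E3} (h : IsInf hπ w v) (h' : IsInf hπ w v') :
    IsInf hπ 0 (v - v') := by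
  simpa [sub_eq_add_neg] using h.add (h'.smul (-1))

theorem IsInf.smul_zero {v : E3} (h : IsInf hπ 0 v) (c : ℝ) : IsInf hπ 0 (c • v) := by
  simpa using h.smul c

theorem IsInf.add_zero {v v' : E3} (h : IsInf hπ 0 v) (h' : IsInf hπ 0 v') :
    IsInf hπ 0 (v + v') := by
  simpa using h.add h'

/-- The adjoint action: (w', v') is the field of g (w, v) g⁻¹, and the two equations express that g
intertwines the two fields. -/
theorem IsInf.conj {w v : E3} (h : IsInf hπ w v) {g : AffAlg}
    (hg : g ∈ (symGroup hπ).toSubmonoid) : ∃ w' v', IsInf hπ w' v' ∧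
      (∀ u, lin g (vcross w u) = vcross w' (lin g u)) ∧
      ∀ p, lin g (vcross w p + v) = vcross w' (pt g p) + v' := by
  obtain ⟨h', hh', h1, h2⟩ := (symGroup hπ).exists_inv' g hg
  obtain ⟨w', v', he, hi⟩ := exists_isInf (hπ := hπ) subset_rfl
    ((symGroup hπ).conj_mem_tangent hg hh' h1 h2 h)
  have key : g * kil w v = kil w' v' * g := by
    rw [← he, mul_assoc, h2, mul_one]
  have k : ∀ x, g (kil w v x) = kil w' v' (g x) := fun x =>
    congrArg (fun f : AffAlg => f x) key
  refine ⟨w', v', hi, fun u => ?_, fun p => ?_⟩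
  · have := congrArg Prod.fst (k (u, 0))
    rw [(isRigid_of_mem hg).apply_lin] at this
    simpa [lin] using this
  · have := congrArg Prod.fst (k (p, 1))
    rw [(isRigid_of_mem hg).apply_pt] at this
    simpa [lin] using this

theorem flow_kil_zero_pt (v p : E3) (t : ℝ) : pt (flow (kil 0 v) t) p = p + t • v := by
  simp [pt, flow_kil_zero_apply]

theorem flow_kil_zero_lin (v u : E3) (t : ℝ) : lin (flow (kil 0 v) t) u = u := by
  simp [lin, flow_kil_zero_apply]

theorem IsInf.map_add {v : E3} (h : IsInf hπ 0 v) {p q : E3} (hpq : π p = π q) :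
    π (p + v) = π (q + v) := by
  have := map_fiber_of_mem (h.flow_mem 1) hpq
  simpa [flow_kil_zero_pt] using this

theorem IsInf.isDir_add {v : E3} (h : IsInf hπ 0 v) {p u : E3} (hd : IsDir π p u) :
    IsDir π (p + v) u := by
  have := hd.map (h.flow_mem 1)
  simpa [flow_kil_zero_pt, flow_kil_zero_lin] using this

/-- At a zero of an infinitesimal symmetry, the fiber is along the axis of rotation. -/
theorem IsInf.cross_eq_zero {w v : E3} (h : IsInf hπ w v) {p u : E3} (hp : vcross w p + v = 0)
    (hu : u ≠ 0) (hd : IsDir π p u) : vcross w u = 0 := by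
  have hfix : ∀ t, pt (flow (kil w v) t) p = p := fun t => by
    rw [pt, flow_apply_of_apply_eq_zero (by simp [hp])]
  have hmem : ∀ t, lin (flow (kil w v) t) u ∈ Submodule.span ℝ {u} := fun t => by
    have := hd.map (h.flow_mem t)
    rw [hfix] at this
    obtain ⟨c, hc⟩ := hπ.exists_smul_of_isDir hu hd this
    rw [hc]
    exact Submodule.smul_mem _ _ (Submodule.mem_span_singleton_self u)
  have := apply_mem_of_flow_mem (fstEval (u, 0)) (Submodule.span ℝ {u}) (X := kil w v) fun t =>
    Submodule.sub_mem _ (hmem t) (Submodule.mem_span_singleton_self u)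
  obtain ⟨c, hc⟩ := Submodule.mem_span_singleton.1 this
  simp only [fstEval_apply, kil_apply, zero_smul, _root_.add_zero] at hc
  -- The flow fixes p and so preserves its fiber, which makes w × u a multiple of u; but it is also
  -- orthogonal to u.
  have h0 : inner ℝ u (vcross w u) = (0 : ℝ) := inner_cross_right w u
  rw [← hc, inner_smul_right] at h0
  have hc0 : c = 0 := (mul_eq_zero.1 h0).resolve_right (inner_self_ne_zero.2 hu)
  rw [← hc, hc0, zero_smul]

theorem isInf_sub_isInf_eq {w v v' : E3} (hT : ∀ x, IsInf hπ 0 x → x = 0) (h : IsInf hπ w v)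
    (h' : IsInf hπ w v') : v = v' :=
  sub_eq_zero.1 (hT _ (h.sub_zero_left h'))

/-- A group meeting all fibers up to translations in a fixed direction is uncountable. -/
theorem not_countable_of_exists_translate {G : ClosedLinearGroup AffAlg}
    (hG : G.carrier ⊆ (symGroup hπ).carrier) (w : E3)
    (h : ∀ p, ∃ g ∈ G.carrier, ∃ r : ℝ, π (pt g 0 + r • w) = π p)
    (hw : IsInf hπ 0 w) : ¬ G.carrier.Countable := by
  intro hc
  obtain ⟨u, hu, hd⟩ := hπ.exists_isDir 0
  have hu0 : u ≠ 0 := by rw [← norm_ne_zero_iff, hu]; exact one_ne_zero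
  -- The fiber through g 0, translated along w, sweeps out at most a plane. Countably many of these
  -- null sets would cover space.
  let A : AffAlg → AffineSubspace ℝ E3 := fun g =>
    AffineSubspace.mk' (pt g 0) (Submodule.span ℝ {w, lin g u})
  have hA : ∀ g, A g ≠ ⊤ := fun g hg => by
    have h1 : (A g).direction = ⊤ := by rw [hg, AffineSubspace.direction_top]
    rw [AffineSubspace.direction_mk'] at h1
    have h2 : Module.finrank ℝ (Submodule.span ℝ {w, lin g u}) ≤ 2 := by
      have := finrank_span_finset_le_card (R := ℝ) ({w, lin g u} : Finset E3)
      rw [Finset.coe_insert, Finset.coe_singleton] at this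
      exact this.trans Finset.card_le_two
    rw [h1, finrank_top, finrank_euclideanSpace, Fintype.card_fin] at h2
    omega
  have hcov : (Set.univ : Set E3) ⊆ ⋃ g ∈ G.carrier, (A g : Set E3) := by
    intro p _
    obtain ⟨g, hg, r, hr⟩ := h p
    have hd1 : IsDir π (pt g 0 + r • w) (lin g u) := (hw.smul_zero r).isDir_add (hd.map (hG hg))
    obtain ⟨s, rfl⟩ := hπ.exists_eq_add ((isRigid_of_mem (hG hg)).lin_ne_zero hu0) hd1 hr.symm
    simp only [Set.mem_iUnion]
    refine ⟨g, hg, ?_⟩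
    rw [SetLike.mem_coe, AffineSubspace.mem_mk', vsub_eq_sub, add_assoc, add_sub_cancel_left]
    exact Submodule.add_mem _
      (Submodule.smul_mem _ _ (Submodule.subset_span (by simp)))
      (Submodule.smul_mem _ _ (Submodule.subset_span (by simp)))
  have h0 : MeasureTheory.volume (Set.univ : Set E3) = 0 := by
    refine MeasureTheory.measure_mono_null hcov ?_
    rw [MeasureTheory.measure_biUnion_null_iff hc]
    exact fun g _ => MeasureTheory.Measure.addHaar_affineSubspace _ _ (hA g)
  rw [MeasureTheory.Measure.measure_univ_eq_zero] at h0
  exact NeZero.ne _ h0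

end LineMaps

/-! ### Recognizing the models from enough symmetries -/

section Classification

theorem exists_unit_orthogonal (u : E3) : ∃ n : E3, ‖n‖ = 1 ∧ inner ℝ u n = (0 : ℝ) := by
  suffices h : ∃ m : E3, m ≠ 0 ∧ inner ℝ u m = (0 : ℝ) by
    obtain ⟨m, hm, hum⟩ := h
    exact ⟨‖m‖⁻¹ • m, norm_smul_inv_norm hm, by rw [inner_smul_right, hum, mul_zero]⟩
  by_cases h0 : vcross u (EuclideanSpace.single 0 1) = 0
  · have a1 : u 2 = 0 := by simpa using congrArg (· 1) h0
    refine ⟨EuclideanSpace.single 2 1, ?_, ?_⟩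
    · intro h
      simpa using congrArg (· 2) h
    · rw [E3.inner_eq]
      simp [a1]
  · exact ⟨_, h0, inner_cross_left _ _⟩

theorem exists_comb_of_cross_ne_zero {a b : E3} (h : vcross a b ≠ 0) (x : E3) :
    ∃ α β γ : ℝ, x = α • a + β • b + γ • vcross a b := by
  -- Cramer's rule with the denominator cleared.
  have key : (inner ℝ (vcross a b) (vcross a b) : ℝ) • x =
      (inner ℝ (vcross x b) (vcross a b) : ℝ) • a + (inner ℝ (vcross a x) (vcross a b) : ℝ) • b +
        (inner ℝ x (vcross a b) : ℝ) • vcross a b := by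
    simp only [E3.inner_eq]
    apply E3.ext_coord <;> simp <;> ring
  have h0 : (inner ℝ (vcross a b) (vcross a b) : ℝ) ≠ 0 := inner_self_ne_zero.2 h
  set N : ℝ := inner ℝ (vcross a b) (vcross a b)
  refine ⟨N⁻¹ * inner ℝ (vcross x b) (vcross a b), N⁻¹ * inner ℝ (vcross a x) (vcross a b),
    N⁻¹ * inner ℝ x (vcross a b), ?_⟩
  rw [mul_smul, mul_smul, mul_smul, ← smul_add, ← smul_add, ← key, smul_smul,
    inv_mul_cancel₀ h0, one_smul]

theorem exists_comb_of_orthogonal {a b n x : E3} (h : vcross a b ≠ 0) (hn : n ≠ 0)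
    (ha : inner ℝ n a = (0 : ℝ)) (hb : inner ℝ n b = (0 : ℝ)) (hx : inner ℝ n x = (0 : ℝ)) :
    ∃ α β : ℝ, x = α • a + β • b := by
  have hc : vcross n (vcross a b) = 0 := by
    rw [vcross_cross_right, ha, hb, zero_smul, zero_smul, sub_zero]
  obtain ⟨k, hk⟩ := exists_smul_of_cross_eq_zero hn hc
  obtain ⟨α, β, γ, rfl⟩ := exists_comb_of_cross_ne_zero h x
  refine ⟨α, β, ?_⟩
  rw [inner_add_right, inner_add_right, inner_smul_right, inner_smul_right, inner_smul_right, ha,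
    hb, mul_zero, mul_zero, zero_add, zero_add] at hx
  rcases mul_eq_zero.1 hx with h1 | h1
  · rw [h1, zero_smul, add_zero]
  · exfalso
    rw [hk, inner_smul_right] at h1
    rcases mul_eq_zero.1 h1 with h2 | h2
    · exact h (by rw [hk, h2, zero_smul])
    · exact hn (inner_self_eq_zero.1 h2)

theorem ne_zero_of_norm_eq_one {u : E3} (hu : ‖u‖ = 1) : u ≠ 0 := by
  rw [← norm_ne_zero_iff, hu]
  exact one_ne_zero

variable {B : Type*} {π : E3 → B}

/-- In suitable Cartesian coordinates the fibers of `π` are the lines of some `fibrationF t`. -/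
def IsModel (π : E3 → B) : Prop :=
  ∃ (t : ℝ) (u n : E3), ‖u‖ = 1 ∧ ‖n‖ = 1 ∧ inner ℝ n u = (0 : ℝ) ∧
    ∀ p, IsDir π p (Real.cos (t * inner ℝ n p) • u + Real.sin (t * inner ℝ n p) • vcross n u)

theorem isModel_of_parallel {u : E3} (hu : u ≠ 0) (h : ∀ p, IsDir π p u) : IsModel π := by
  obtain ⟨n, hn, hun⟩ := exists_unit_orthogonal u
  refine ⟨0, ‖u‖⁻¹ • u, n, norm_smul_inv_norm hu, hn, ?_, fun p => ?_⟩
  · rw [inner_smul_right, real_inner_comm, hun, mul_zero]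
  · simpa using (h p).smul _

variable [TopologicalSpace B] [T2Space B] {hπ : IsLineMap π}

/-- If one fiber is parallel to a direction that all symmetries preserve, transitivity makes every
fiber parallel to it. -/
theorem isModel_of_fixed_direction
    (htr : ∀ p q, ∃ g ∈ (symGroup hπ).toSubmonoid, π (pt g p) = π q) {n p : E3} (hn : n ≠ 0)
    (hG : ∀ g ∈ (symGroup hπ).toSubmonoid, ∃ c : ℝ, lin g n = c • n) (hd : IsDir π p n) :
    IsModel π := by
  refine isModel_of_parallel hn fun q => ?_
  obtain ⟨g, hg, hgq⟩ := htr p q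
  obtain ⟨c, hc⟩ := hG g hg
  have h1 := (hd.map hg).smul c⁻¹
  have hc0 : c ≠ 0 := by
    rintro rfl
    exact (isRigid_of_mem hg).lin_ne_zero hn (by rw [hc, zero_smul])
  rw [hc, smul_smul, inv_mul_cancel₀ hc0, one_smul] at h1
  exact hπ.isDir_of_eq h1 hgq.symm

theorem isModel_of_all_translations (h : ∀ v, IsInf hπ 0 v) : IsModel π := by
  obtain ⟨u, hu, hd⟩ := hπ.exists_isDir 0
  refine isModel_of_parallel (ne_zero_of_norm_eq_one hu) fun p => ?_
  simpa using (h p).isDir_add hd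

/-- A screw motion about the axis `n`. -/
theorem flow_screw {n u : E3} (a : ℝ) (hn : ‖n‖ = 1) (hu : inner ℝ n u = (0 : ℝ)) (t : ℝ) :
    pt (flow (kil (a • n) n) t) 0 = t • n ∧
    lin (flow (kil (a • n) n) t) u = Real.cos (t * a) • u + Real.sin (t * a) • vcross n u := by
  have hnn : (inner ℝ n n : ℝ) = 1 := by rw [real_inner_self_eq_norm_sq, hn, one_pow]
  constructor
  · have := flow_apply_of_hasDerivAt (kil (a • n) n) (γ := fun t => (t • n, 1)) (fun t => ?_) t
    · rw [zero_smul] at this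
      rw [pt, this]
    · have h1 : HasDerivAt (fun t : ℝ => t • n) n t := by
        simpa using (hasDerivAt_id t).smul_const n
      have h2 := h1.prodMk (hasDerivAt_const t (1 : ℝ))
      convert h2 using 1
      simp [vcross_smul_left, vcross_smul_right]
  · have := flow_apply_of_hasDerivAt (kil (a • n) n)
      (γ := fun t => (Real.cos (t * a) • u + Real.sin (t * a) • vcross n u, 0)) (fun t => ?_) t
    · rw [zero_mul, Real.cos_zero, Real.sin_zero, one_smul, zero_smul, add_zero] at this
      rw [lin, this]
    · have h0 : HasDerivAt (fun t : ℝ => t * a) a t := by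
        simpa using (hasDerivAt_id t).mul_const a
      have h1 : HasDerivAt (fun t => Real.cos (t * a) • u + Real.sin (t * a) • vcross n u)
          ((-Real.sin (t * a) * a) • u + (Real.cos (t * a) * a) • vcross n u) t :=
        (h0.cos.smul_const u).add (h0.sin.smul_const (vcross n u))
      refine (h1.prodMk (hasDerivAt_const t (0 : ℝ))).congr_deriv (Prod.ext ?_ rfl)
      simp only [kil_apply, vcross_smul_left, vcross_add_right, vcross_smul_right,
        vcross_cross_right, real_inner_smul_left, hu, hnn]
      module

theorem isModel_of_plane
    (htr : ∀ p q, ∃ g ∈ (symGroup hπ).toSubmonoid, π (pt g p) = π q) {n : E3} (hn : ‖n‖ = 1)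
    (hT : ∀ v, inner ℝ n v = (0 : ℝ) → IsInf hπ 0 v) : IsModel π := by
  have hn0 := ne_zero_of_norm_eq_one hn
  have hnn : (inner ℝ n n : ℝ) = 1 := by rw [real_inner_self_eq_norm_sq, hn, one_pow]
  -- A fiber transverse to the plane meets every parallel plane, so the translations alone carry it
  -- through every point.
  by_cases hor : ∃ p u, IsDir π p u ∧ inner ℝ n u ≠ (0 : ℝ)
  · obtain ⟨p, u, hd, hu⟩ := hor
    have hu0 : u ≠ 0 := by
      rintro rfl
      exact hu (inner_zero_right n)
    refine isModel_of_parallel hu0 fun q => ?_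
    set s : ℝ := (inner ℝ n u)⁻¹ * inner ℝ n (q - p)
    have hv : inner ℝ n (q - p - s • u) = (0 : ℝ) := by
      rw [inner_sub_right, inner_smul_right]
      simp only [s]
      field_simp
      ring
    have h1 := (hT _ hv).isDir_add (hπ.isDir_of_eq hd (hd s))
    have : p + s • u + (q - p - s • u) = q := by abel
    rwa [this] at h1
  push Not at hor
  obtain ⟨u, hu, hd⟩ := hπ.exists_isDir 0
  have hu0 := ne_zero_of_norm_eq_one hu
  by_cases hpar : ∀ p v, IsDir π p v → vcross u v = 0
  · refine isModel_of_parallel hu0 fun p => ?_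
    obtain ⟨v, hv, hdv⟩ := hπ.exists_isDir p
    have hv0 := ne_zero_of_norm_eq_one hv
    have h0 := hpar p v hdv
    obtain ⟨c, rfl⟩ := exists_smul_of_cross_eq_zero hu0 h0
    have hc0 : c ≠ 0 := by
      rintro rfl
      exact hv0 (zero_smul _ _)
    have := hdv.smul c⁻¹
    rwa [smul_smul, inv_mul_cancel₀ hc0, one_smul] at this
  push Not at hpar
  obtain ⟨p, v, hdv, huv⟩ := hpar
  -- Symmetries permute fiber directions, all of which are orthogonal to n. Two of them are
  -- independent, so the normal n is determined up to scale and g preserves its line.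
  have hlin : ∀ g ∈ (symGroup hπ).toSubmonoid, lin g n ∈ Submodule.span ℝ {n} := by
    intro g hg
    have hr := isRigid_of_mem hg
    obtain ⟨h, hh, h1, h2⟩ := (symGroup hπ).exists_inv' g hg
    have hrh := isRigid_of_mem (hπ := hπ) hh
    obtain ⟨k, hk⟩ : ∃ k : ℝ, vcross u v = k • n := by
      refine exists_smul_of_cross_eq_zero hn0 ?_
      rw [vcross_cross_right, hor _ _ hd, hor _ _ hdv, zero_smul, zero_smul, sub_zero]
    have horth : ∀ x q, IsDir π q x → inner ℝ x (lin g n) = (0 : ℝ) := fun x q hx => by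
      have e1 := hor _ _ (hx.map hh)
      have e2 : lin g (lin h x) = x := by rw [← lin_mul _ hrh, h1, lin_one]
      rw [← hr.inner_lin, e2, real_inner_comm] at e1
      exact e1
    have hc : vcross (vcross u v) (lin g n) = 0 := by
      rw [vcross_cross_left, horth _ _ hd, horth _ _ hdv, zero_smul, zero_smul, sub_zero]
    rw [mem_span_singleton_iff_cross hn0]
    rw [hk, vcross_smul_left] at hc
    refine (smul_eq_zero.1 hc).resolve_left ?_
    rintro rfl
    exact huv (by rw [hk, zero_smul])
  have hcl : ∀ S : Submodule ℝ E3, IsClosed (S : Set E3) := fun S => S.closed_of_finiteDimensional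
  -- Restricting to symmetries that move the origin along n discards the known translations.
  -- Correcting by such a translation brings any symmetry into G', so G' still reaches every height
  -- and is uncountable.
  let G' := (symGroup hπ).cut (fun g => pt g 0 ∈ Submodule.span ℝ {n})
    ((hcl _).preimage (continuous_pt 0)) (Submodule.zero_mem _)
    (fun g hg h hh h1 h2 => by
      rw [pt_mul _ (isRigid_of_mem hh), ← zero_add (pt h 0), pt_add]
      refine Submodule.add_mem _ h1 ?_
      obtain ⟨c, hc⟩ := Submodule.mem_span_singleton.1 h2
      rw [← hc, lin_smul]
      exact Submodule.smul_mem _ _ (hlin g hg))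
    (fun g hg h hh hgh h1 => by
      have e1 : pt h (pt g 0) = 0 := by
        obtain ⟨h', hh', e1, e2⟩ := (symGroup hπ).exists_inv' g hg
        have : h = h' := (left_inv_eq_right_inv e2 hgh).symm
        rw [← pt_mul _ (isRigid_of_mem hg), this, e2, pt_one]
      obtain ⟨c, hc⟩ := Submodule.mem_span_singleton.1 h1
      rw [← hc, ← zero_add (c • n), pt_add, lin_smul] at e1
      rw [eq_neg_of_add_eq_zero_left e1]
      exact Submodule.neg_mem _ (Submodule.smul_mem _ _ (hlin h hh)))
  have hsub : G'.carrier ⊆ (symGroup hπ).carrier := Set.inter_subset_left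
  have hunc : ¬ G'.carrier.Countable := by
    intro hcount
    have himg : (fun g => (inner ℝ n (pt g 0) : ℝ)) '' G'.carrier = Set.univ := by
      refine Set.eq_univ_of_forall fun z => ?_
      obtain ⟨g, hg, hgz⟩ := htr 0 (z • n)
      set x := z • n - pt g 0
      have hz : inner ℝ n x = (0 : ℝ) := by
        obtain ⟨v, hv, hdv⟩ := hπ.exists_isDir (pt g 0)
        obtain ⟨s, hs⟩ := hπ.exists_eq_add (ne_zero_of_norm_eq_one hv) hdv hgz.symm
        have hx : x = s • v := by simp only [x, hs, add_sub_cancel_left]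
        rw [hx, inner_smul_right, hor _ _ hdv, mul_zero]
      have hpt : pt (flow (kil 0 x) 1 * g) 0 = z • n := by
        rw [pt_mul _ (isRigid_of_mem hg), flow_kil_zero_pt, one_smul]
        simp [x]
      refine ⟨flow (kil 0 x) 1 * g, ⟨(symGroup hπ).mul_mem ((hT x hz).flow_mem 1) hg, ?_⟩, ?_⟩
      · simp only [Set.mem_ofPred_eq, hpt]
        exact Submodule.smul_mem _ _ (Submodule.mem_span_singleton_self n)
      · simp only [hpt, inner_smul_right, hnn, mul_one]
    exact Set.not_countable_univ (himg ▸ hcount.image _)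
  obtain ⟨X, hX, hX0⟩ := G'.exists_ne_zero_mem_tangent hunc
  obtain ⟨w, y, rfl, hi⟩ := exists_isInf hsub hX
  have hy : y ∈ Submodule.span ℝ {n} := by
    have := apply_mem_of_flow_mem (fstEval (0, 1)) (Submodule.span ℝ {n}) (X := kil w y) fun t => by
      have : (1 : AffAlg) ((0, 1) : E3 × ℝ) = (0, 1) := rfl
      rw [fstEval_apply, fstEval_apply, this, sub_zero]
      exact (ClosedLinearGroup.mem_tangent.1 hX t).2
    simpa using this
  have hw : vcross n w = 0 := by
    have h1 := apply_mem_of_flow_mem (fstEval (n, 0)) (Submodule.span ℝ {n}) (X := kil w y)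
      fun t => Submodule.sub_mem _ (hlin _ (hi.flow_mem t)) (Submodule.mem_span_singleton_self n)
    simp only [fstEval_apply, kil_apply, zero_smul, add_zero] at h1
    obtain ⟨c, hc⟩ := Submodule.mem_span_singleton.1 h1
    have h2 : inner ℝ n (vcross w n) = (0 : ℝ) := inner_cross_right _ _
    rw [← hc, inner_smul_right, hnn, mul_one] at h2
    rw [vcross_anticomm, ← hc, h2, zero_smul, neg_zero]
  obtain ⟨a, rfl⟩ := exists_smul_of_cross_eq_zero hn0 hw
  obtain ⟨b, rfl⟩ := Submodule.mem_span_singleton.1 hy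
  have hnu := hor _ _ hd
  -- For b = 0 the field is a rotation about an axis through the origin, so the fiber there would be
  -- vertical instead of horizontal.
  have hb : b ≠ 0 := by
    rintro rfl
    have h1 := hi.cross_eq_zero (p := 0) (by simp) hu0 hd
    rw [vcross_smul_left] at h1
    rcases smul_eq_zero.1 h1 with rfl | h2
    · simp only [zero_smul] at hX0
      refine hX0 (affAlg_ext fun p s => ?_)
      simp
    · have h3 := vcross_cross_right n n u
      rw [h2, vcross_zero_right, hnu, hnn, zero_smul, one_smul, zero_sub, eq_comm, neg_eq_zero] at h3
      exact hu0 h3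
  have hi' := hi.smul b⁻¹
  rw [smul_smul, smul_smul, inv_mul_cancel₀ hb, one_smul] at hi'
  refine ⟨b⁻¹ * a, u, n, hu, hn, hnu, fun p => ?_⟩
  -- The normalized screw climbs to the height z of p in time z, and a horizontal translation then
  -- reaches p.
  set z : ℝ := inner ℝ n p with hz
  obtain ⟨e1, e2⟩ := flow_screw (b⁻¹ * a) hn hnu z
  have h1 := hd.map (hi'.flow_mem z)
  rw [e1, e2] at h1
  have hp : inner ℝ n (p - z • n) = (0 : ℝ) := by
    rw [inner_sub_right, inner_smul_right, hnn, mul_one, hz, sub_self]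
  have h2 := (hT _ hp).isDir_add h1
  rwa [add_sub_cancel, mul_comm z] at h2

theorem isModel_of_two_translations
    (htr : ∀ p q, ∃ g ∈ (symGroup hπ).toSubmonoid, π (pt g p) = π q) {y z : E3}
    (hy : IsInf hπ 0 y) (hz : IsInf hπ 0 z) (hyz : vcross y z ≠ 0) : IsModel π := by
  have hN : ‖vcross y z‖⁻¹ ≠ 0 := inv_ne_zero (norm_ne_zero_iff.2 hyz)
  refine isModel_of_plane htr (n := ‖vcross y z‖⁻¹ • vcross y z) (norm_smul_inv_norm hyz)
    fun v hv => ?_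
  rw [real_inner_smul_left] at hv
  obtain ⟨α, β, rfl⟩ := exists_comb_of_orthogonal hyz hyz
    (by rw [real_inner_comm]; exact inner_cross_left y z)
    (by rw [real_inner_comm]; exact inner_cross_right y z)
    ((mul_eq_zero.1 hv).resolve_left hN)
  exact (hy.smul_zero α).add_zero (hz.smul_zero β)

end Classification

/-! ### Case analysis on the rotation parts -/

section Cases

variable {B : Type*} {π : E3 → B} [TopologicalSpace B]

/-- No map has all its fibers meeting a fixed axis at a constant nonzero angle. -/
theorem false_of_fibers_meet_axis {o w : E3} (hw : w ≠ 0) {κ : ℝ}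
    (hmeet : ∀ q, ∃ r : ℝ, π (o + r • w) = π q)
    (hangle : ∀ q, ∃ u, ‖u‖ = 1 ∧ IsDir π q u ∧ (inner ℝ u w : ℝ) ^ 2 = κ)
    (hπ : IsLineMap π) : False := by
  have hww : (0 : ℝ) < inner ℝ w w := real_inner_self_pos.2 hw
  set N : ℝ := inner ℝ w w
  obtain ⟨e, he, hwe⟩ := exists_unit_orthogonal w
  have hee : (inner ℝ e e : ℝ) = 1 := by rw [real_inner_self_eq_norm_sq, he, one_pow]
  set f := vcross w e
  have hwf : inner ℝ w f = (0 : ℝ) := inner_cross_left w e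
  have hef : inner ℝ e f = (0 : ℝ) := inner_cross_right w e
  have hff : (inner ℝ f f : ℝ) = N := by
    have h1 : (inner ℝ f f : ℝ) = inner ℝ w w * inner ℝ e e - (inner ℝ w e) ^ 2 := by
      simp only [f, E3.inner_eq]
      simp
      ring
    rw [h1, hee, hwe]
    ring
  have hf0 : f ≠ 0 := fun h => by
    rw [h, inner_zero_left] at hff
    exact hww.ne hff
  -- Pythagoras and the angle condition on the segment from o + x to the axis: |x| determines r².
  have key : ∀ x : E3, inner ℝ w x = (0 : ℝ) → ∃ r : ℝ, π (o + r • w) = π (o + x) ∧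
      (inner ℝ x x + r ^ 2 * N) * κ = r ^ 2 * N ^ 2 := by
    intro x hx
    obtain ⟨r, hr⟩ := hmeet (o + x)
    refine ⟨r, hr, ?_⟩
    obtain ⟨u, hu, hd, hk⟩ := hangle (o + x)
    obtain ⟨s, hs⟩ := hπ.exists_eq_add (ne_zero_of_norm_eq_one hu) hd hr
    rw [add_assoc, add_right_inj] at hs
    have hsu : s • u = r • w - x := by rw [hs]; abel
    have e1 : s ^ 2 = inner ℝ x x + r ^ 2 * N := by
      have h1 : (inner ℝ (s • u) (s • u) : ℝ) = s ^ 2 := by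
        rw [real_inner_smul_left, inner_smul_right, real_inner_self_eq_norm_sq, hu]
        ring
      rw [← h1, hsu]
      simp only [inner_sub_left, inner_sub_right, real_inner_smul_left, inner_smul_right, hx,
        real_inner_comm w x]
      ring
    have e2 : s * inner ℝ u w = r * N := by
      rw [← real_inner_smul_left, hsu, inner_sub_left, real_inner_smul_left, real_inner_comm w x, hx,
        sub_zero]
    rw [← e1, ← hk, ← mul_pow, e2]
    ring
  -- A fiber through o + r • w either crosses the plane o + w^⊥ in at most one point, or lies in it
  -- and passes through o; in both cases y is a multiple of x.
  have inj : ∀ x y : E3, inner ℝ w x = (0 : ℝ) → inner ℝ w y = (0 : ℝ) → x ≠ 0 → ∀ r : ℝ,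
      π (o + r • w) = π (o + x) → π (o + r • w) = π (o + y) → ∃ l : ℝ, y = l • x := by
    intro x y hx hy hx0 r h1 h2
    obtain ⟨u, hu, hd⟩ := hπ.exists_isDir (o + r • w)
    have hu0 := ne_zero_of_norm_eq_one hu
    obtain ⟨a, ha⟩ := hπ.exists_eq_add hu0 hd h1.symm
    obtain ⟨b, hb⟩ := hπ.exists_eq_add hu0 hd h2.symm
    rw [add_assoc, add_right_inj] at ha hb
    have ha' : r * N + a * inner ℝ w u = 0 := by
      rw [← hx, ha, inner_add_right, inner_smul_right, inner_smul_right]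
    have hb' : r * N + b * inner ℝ w u = 0 := by
      rw [← hy, hb, inner_add_right, inner_smul_right, inner_smul_right]
    by_cases hwu : (inner ℝ w u : ℝ) = 0
    · have hr : r = 0 := by
        rw [hwu, mul_zero, add_zero] at ha'
        exact (mul_eq_zero.1 ha').resolve_right hww.ne'
      rw [hr, zero_smul, zero_add] at ha hb
      have ha0 : a ≠ 0 := by
        rintro rfl
        exact hx0 (by rw [ha, zero_smul])
      exact ⟨b * a⁻¹, by rw [ha, hb, smul_smul, inv_mul_cancel_right₀ ha0]⟩
    · have hab : a = b := by
        have : (a - b) * inner ℝ w u = 0 := by linarith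
        exact sub_eq_zero.1 ((mul_eq_zero.1 this).resolve_right hwu)
      exact ⟨1, by rw [one_smul, ha, hb, hab]⟩
  have hsq : ∀ a b : ℝ, ∀ c, 0 < c → (c + a * N) * κ = a * N ^ 2 → (c + b * N) * κ = b * N ^ 2 →
      a = b := by
    intro a b c hc h1 h2
    have h3 : (a - b) * (N * (κ - N)) = 0 := by linarith
    rcases mul_eq_zero.1 h3 with h4 | h4
    · linarith
    · exfalso
      have h5 : κ = N := by
        have := (mul_eq_zero.1 h4).resolve_left hww.ne'
        linarith
      rw [h5] at h1
      have : c * N = 0 := by linarith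
      exact (mul_pos hc hww).ne' this
  obtain ⟨e', hwe', he'e', he'f⟩ : ∃ e' : E3, (inner ℝ w e' : ℝ) = 0 ∧
      (inner ℝ e' e' : ℝ) = N ∧ (inner ℝ e' f : ℝ) = 0 := by
    refine ⟨Real.sqrt N • e, ?_, ?_, ?_⟩
    · rw [inner_smul_right, hwe, mul_zero]
    · rw [real_inner_smul_left, inner_smul_right, hee, mul_one, Real.mul_self_sqrt hww.le]
    · rw [real_inner_smul_left, hef, mul_zero]
  have hfe' : (inner ℝ f e' : ℝ) = 0 := by rw [real_inner_comm, he'f]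
  -- The 3-4-5 triangle gives a third vector of the same length as e' and f, parallel to neither.
  -- Three values of r with one common square cannot be distinct, yet `inj` requires it.
  obtain ⟨d, hwd, he'd, hfd, hdd⟩ : ∃ d : E3, (inner ℝ w d : ℝ) = 0 ∧
      (inner ℝ e' d : ℝ) = 3 / 5 * N ∧ (inner ℝ f d : ℝ) = 4 / 5 * N ∧ (inner ℝ d d : ℝ) = N := by
    refine ⟨(3 / 5 : ℝ) • e' + (4 / 5 : ℝ) • f, ?_, ?_, ?_, ?_⟩ <;>
      simp only [inner_add_left, inner_add_right, real_inner_smul_left, inner_smul_right, hwe',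
        hwf, he'e', he'f, hfe', hff] <;> ring
  have he'0 : e' ≠ 0 := fun h => by
    rw [h, inner_zero_left] at he'e'
    exact hww.ne he'e'
  obtain ⟨r1, p1, q1⟩ := key e' hwe'
  obtain ⟨r2, p2, q2⟩ := key f hwf
  obtain ⟨r3, p3, q3⟩ := key d hwd
  rw [he'e'] at q1
  rw [hff] at q2
  rw [hdd] at q3
  have n12 : r1 ≠ r2 := by
    rintro rfl
    obtain ⟨l, hl⟩ := inj _ _ hwe' hwf he'0 r1 p1 p2
    have := hff
    nth_rw 1 [hl] at this
    rw [real_inner_smul_left, he'f, mul_zero] at this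
    exact hww.ne this
  have n13 : r1 ≠ r3 := by
    rintro rfl
    obtain ⟨l, hl⟩ := inj _ _ hwe' hwd he'0 r1 p1 p3
    rw [hl, inner_smul_right, hfe', mul_zero] at hfd
    linarith
  have n23 : r2 ≠ r3 := by
    rintro rfl
    obtain ⟨l, hl⟩ := inj _ _ hwf hwd hf0 r2 p2 p3
    rw [hl, inner_smul_right, he'f, mul_zero] at he'd
    linarith
  have s12 := (sq_eq_sq_iff_eq_or_eq_neg.1 (hsq _ _ _ hww q1 q2)).resolve_left n12
  have s13 := (sq_eq_sq_iff_eq_or_eq_neg.1 (hsq _ _ _ hww q1 q3)).resolve_left n13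
  exact n23 (by linarith)

variable [T2Space B] {hπ : IsLineMap π}

/-- The case where the rotation parts of the infinitesimal symmetries span `E3`. -/
theorem isModel_of_nonparallel_rotations {w₁ v₁ w₂ v₂ : E3} (h₁ : IsInf hπ w₁ v₁)
    (h₂ : IsInf hπ w₂ v₂) (hw : vcross w₁ w₂ ≠ 0) : IsModel π := by
  have hall : ∀ w, ∃ v, IsInf hπ w v := fun w => by
    obtain ⟨α, β, γ, rfl⟩ := exists_comb_of_cross_ne_zero hw w
    exact ⟨_, ((h₁.smul α).add (h₂.smul β)).add ((h₁.bracket h₂).smul γ)⟩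
  by_cases hT : ∀ x, IsInf hπ 0 x → x = 0
  -- Without translations v is a function of w compatible with brackets, so the fields are the
  -- rotations about a single point.
  · exfalso
    obtain ⟨v1, i1⟩ := hall (EuclideanSpace.single 0 1)
    obtain ⟨v2, i2⟩ := hall (EuclideanSpace.single 1 1)
    obtain ⟨v3, i3⟩ := hall (EuclideanSpace.single 2 1)
    have c12 : vcross (EuclideanSpace.single 0 1) (EuclideanSpace.single 1 1) =
        EuclideanSpace.single 2 (1 : ℝ) := by
      apply E3.ext_coord <;> simp
    have c23 : vcross (EuclideanSpace.single 1 1) (EuclideanSpace.single 2 1) =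
        EuclideanSpace.single 0 (1 : ℝ) := by
      apply E3.ext_coord <;> simp
    have c31 : vcross (EuclideanSpace.single 2 1) (EuclideanSpace.single 0 1) =
        EuclideanSpace.single 1 (1 : ℝ) := by
      apply E3.ext_coord <;> simp
    have b12 := i1.bracket i2
    have b23 := i2.bracket i3
    have b31 := i3.bracket i1
    rw [c12] at b12
    rw [c23] at b23
    rw [c31] at b31
    have r3 := isInf_sub_isInf_eq hT i3 b12
    have r1 := isInf_sub_isInf_eq hT i1 b23
    have r2 := isInf_sub_isInf_eq hT i2 b31
    have r30 := congrArg (· 0) r3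
    have r31 := congrArg (· 1) r3
    have r32 := congrArg (· 2) r3
    have r10 := congrArg (· 0) r1
    have r11 := congrArg (· 1) r1
    have r12 := congrArg (· 2) r1
    have r20 := congrArg (· 0) r2
    have r21 := congrArg (· 1) r2
    have r22 := congrArg (· 2) r2
    simp at r30 r31 r32 r10 r11 r12 r20 r21 r22
    -- The common zero, read off from v1 = -(e1 × p) and v2 = -(e2 × p); the fiber through it would
    -- be parallel to two different axes.
    let p : E3 := !₂[v2 2, -v1 2, v1 1]
    obtain ⟨u, hu, hd⟩ := hπ.exists_isDir p
    have hu0 := ne_zero_of_norm_eq_one hu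
    have z1 := i1.cross_eq_zero (p := p)
      (by apply E3.ext_coord <;> simp [p] <;> linarith) hu0 hd
    have z2 := i2.cross_eq_zero (p := p)
      (by apply E3.ext_coord <;> simp [p] <;> linarith) hu0 hd
    have u2 := congrArg (· 1) z1
    have u1 := congrArg (· 2) z1
    have u0 := congrArg (· 2) z2
    simp at u0 u1 u2
    exact hu0 (E3.ext_coord u0 u1 u2)
  · push Not at hT
    obtain ⟨x, hx, hx0⟩ := hT
    have hcr : ∀ w, IsInf hπ 0 (vcross w x) := fun w => by
      obtain ⟨v, hv⟩ := hall w
      exact hv.bracket_zero hx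
    obtain ⟨n, hn, hxn⟩ := exists_unit_orthogonal x
    have hn0 := ne_zero_of_norm_eq_one hn
    have hxx : (inner ℝ x x : ℝ) ≠ 0 := inner_self_ne_zero.2 hx0
    -- Since n ⊥ x, the double product (x × n) × x equals |x|² n.
    have in1 : IsInf hπ 0 n := by
      have h1 := (hcr (vcross x n)).smul_zero (inner ℝ x x : ℝ)⁻¹
      rwa [vcross_cross_left, real_inner_comm x n, hxn, zero_smul, sub_zero, smul_smul,
        inv_mul_cancel₀ hxx, one_smul] at h1
    have in2 : IsInf hπ 0 (vcross x n) := by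
      obtain ⟨v, hv⟩ := hall x
      exact hv.bracket_zero in1
    have hne : vcross x n ≠ 0 := by
      intro h0
      have h1 := vcross_cross_right x x n
      rw [h0, vcross_zero_right, hxn, zero_smul, zero_sub, eq_comm, neg_eq_zero] at h1
      exact (smul_ne_zero hxx hn0) h1
    refine isModel_of_all_translations (hπ := hπ) fun v => ?_
    obtain ⟨α, β, γ, rfl⟩ := exists_comb_of_cross_ne_zero hne v
    exact ((hx.smul_zero α).add_zero (in1.smul_zero β)).add_zero (in2.smul_zero γ)

/-- The case where all rotation parts are parallel and not all zero. -/
theorem isModel_of_parallel_rotations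
    (htr : ∀ p q, ∃ g ∈ (symGroup hπ).toSubmonoid, π (pt g p) = π q) {w v : E3}
    (h : IsInf hπ w v) (hw : w ≠ 0) (hpar : ∀ w' v', IsInf hπ w' v' → vcross w w' = 0) :
    IsModel π := by
  have hww : (inner ℝ w w : ℝ) ≠ 0 := inner_self_ne_zero.2 hw
  obtain ⟨m, hm, hwm⟩ := exists_unit_orthogonal w
  have hm0 := ne_zero_of_norm_eq_one hm
  have hwm0 : vcross w m ≠ 0 := by
    intro h0
    have h1 := vcross_cross_right w w m
    rw [h0, vcross_zero_right, hwm, zero_smul, zero_sub, eq_comm, neg_eq_zero] at h1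
    exact (smul_ne_zero hww hm0) h1
  -- Conjugation by g gives another field, whose rotation part must be a multiple of w; hence g
  -- preserves the direction of w.
  have hconj : ∀ g ∈ (symGroup hπ).toSubmonoid, ∃ k : ℝ, k ≠ 0 ∧ ∃ v', IsInf hπ (k • w) v' ∧
      vcross w (lin g w) = 0 ∧ ∀ p, lin g (vcross w p + v) = k • vcross w (pt g p) + v' := by
    intro g hg
    obtain ⟨w', v', hi, hl, hp⟩ := h.conj hg
    obtain ⟨k, rfl⟩ := exists_smul_of_cross_eq_zero hw (hpar _ _ hi)
    have hk : k ≠ 0 := by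
      rintro rfl
      have := hl m
      rw [zero_smul, vcross_zero_left] at this
      exact (isRigid_of_mem hg).lin_ne_zero hwm0 this
    refine ⟨k, hk, v', hi, ?_, fun p => by rw [hp, vcross_smul_left]⟩
    have := hl w
    rw [vcross_self, vcross_smul_left, ← zero_smul ℝ (0 : E3), lin_smul, zero_smul] at this
    exact (smul_eq_zero.1 this.symm).resolve_left hk
  have hlin : ∀ g ∈ (symGroup hπ).toSubmonoid, ∃ c : ℝ, lin g w = c • w := fun g hg => by
    obtain ⟨k, hk, v', -, h1, -⟩ := hconj g hg
    exact exists_smul_of_cross_eq_zero hw h1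
  -- For a pure rotation the fiber through a point o of the axis is the axis itself, and its
  -- direction is preserved by all symmetries.
  have haxis : ∀ y, IsInf hπ w y → ∀ o, vcross w o + y = 0 → IsModel π := by
    intro y hy o ho
    obtain ⟨u, hu, hd⟩ := hπ.exists_isDir o
    have hu0 := ne_zero_of_norm_eq_one hu
    obtain ⟨c, hc⟩ := exists_smul_of_cross_eq_zero hw (hy.cross_eq_zero ho hu0 hd)
    have hc0 : c ≠ 0 := by
      rintro rfl
      exact hu0 (by rw [hc, zero_smul])
    have hd' := hd.smul c⁻¹
    rw [hc, smul_smul, inv_mul_cancel₀ hc0, one_smul] at hd'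
    exact isModel_of_fixed_direction htr hw hlin hd'
  by_cases hT : ∃ x, IsInf hπ 0 x ∧ vcross w x ≠ 0
  · obtain ⟨x, hx, hwx⟩ := hT
    -- Bracketing twice yields the orthogonal nonzero translations w × x and w × (w × x).
    have i1 := h.bracket_zero hx
    refine isModel_of_two_translations htr i1 (h.bracket_zero i1) ?_
    rw [vcross_cross_right, real_inner_comm w, inner_cross_left, zero_smul, sub_zero]
    exact smul_ne_zero (inner_self_ne_zero.2 hwx) hw
  push Not at hT
  -- o is a point of the screw axis: it cancels the part of v orthogonal to w and leaves the pitch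
  -- c.
  obtain ⟨o, c, hoc⟩ : ∃ (o : E3) (c : ℝ), vcross w o + v = c • w := by
    refine ⟨(inner ℝ w w : ℝ)⁻¹ • vcross w v, (inner ℝ w w : ℝ)⁻¹ * inner ℝ w v, ?_⟩
    rw [vcross_smul_right, vcross_cross_right, smul_sub, smul_smul, smul_smul,
      inv_mul_cancel₀ hww, one_smul, sub_add_cancel]
  by_cases hT0 : ∃ x, IsInf hπ 0 x ∧ x ≠ 0
  · obtain ⟨x, hx, hx0⟩ := hT0
    obtain ⟨k, rfl⟩ := exists_smul_of_cross_eq_zero hw (hT x hx)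
    have hk : k ≠ 0 := by
      rintro rfl
      exact hx0 (zero_smul _ _)
    -- A translation along the axis cancels the pitch.
    have hi : IsInf hπ w (v + (-c * k⁻¹) • k • w) := by
      simpa using h.add (hx.smul (-c * k⁻¹))
    refine haxis _ hi o ?_
    rw [← add_assoc, hoc, smul_smul, inv_mul_cancel_right₀ hk, ← add_smul, add_neg_cancel,
      zero_smul]
  push Not at hT0
  by_cases hc : c = 0
  · exact haxis v h o (by rw [hoc, hc, zero_smul])
  exfalso
  -- With no translations, the conjugate by g of the screw is k times the screw itself, so g maps
  -- its axis to itself.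
  have hfix : ∀ g ∈ (symGroup hπ).toSubmonoid, ∃ r : ℝ, pt g o = o + r • w := by
    intro g hg
    obtain ⟨k, hk, v', hi, h1, h2⟩ := hconj g hg
    have hv' : v' = k • v := isInf_sub_isInf_eq hT0 hi (h.smul k)
    obtain ⟨a, ha⟩ := hlin g hg
    have h3 := h2 o
    rw [hoc, lin_smul, ha, hv', ← smul_add] at h3
    have h4 : vcross w (pt g o) + v = vcross w (pt g o - o) + c • w := by
      rw [← hoc, vcross_sub_right]; abel
    rw [h4] at h3
    have h5 : vcross w (pt g o - o) = (k⁻¹ * (c * a) - c) • w := by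
      rw [sub_smul, mul_smul, mul_smul, h3, smul_smul, inv_mul_cancel₀ hk, one_smul,
        add_sub_cancel_right]
    have h6 : inner ℝ w (vcross w (pt g o - o)) = (0 : ℝ) := inner_cross_left _ _
    rw [h5, inner_smul_right] at h6
    rw [(mul_eq_zero.1 h6).resolve_right hww, zero_smul] at h5
    obtain ⟨r, hr⟩ := exists_smul_of_cross_eq_zero hw h5
    exact ⟨r, by rw [← hr, add_sub_cancel]⟩
  obtain ⟨u, hu, hd⟩ := hπ.exists_isDir o
  refine false_of_fibers_meet_axis (π := π) (o := o) hw (κ := (inner ℝ u w : ℝ) ^ 2)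
    (fun q => ?_) (fun q => ?_) hπ
  · obtain ⟨g, hg, hgq⟩ := htr o q
    obtain ⟨r, hr⟩ := hfix g hg
    exact ⟨r, by rw [← hr, hgq]⟩
  · obtain ⟨g, hg, hgq⟩ := htr o q
    have hr := isRigid_of_mem hg
    refine ⟨lin g u, by rw [hr.norm, hu], hπ.isDir_of_eq (hd.map hg) hgq.symm, ?_⟩
    obtain ⟨a, ha⟩ := hlin g hg
    have e1 := hr.inner_lin u w
    have e2 := hr.inner_lin w w
    rw [ha, inner_smul_right] at e1
    rw [ha, inner_smul_right, real_inner_smul_left] at e2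
    have e3 : a ^ 2 = 1 := by
      have : (a ^ 2 - 1) * (inner ℝ w w : ℝ) = 0 := by linarith
      linarith [(mul_eq_zero.1 this).resolve_right hww]
    rw [← e1, mul_pow, e3, one_mul]

/-- The case where all infinitesimal symmetries are translations. -/
theorem isModel_of_only_translations
    (htr : ∀ p q, ∃ g ∈ (symGroup hπ).toSubmonoid, π (pt g p) = π q)
    (h : ∀ w v, IsInf hπ w v → w = 0) : IsModel π := by
  have hne : ∀ {w v : E3}, kil w v ≠ 0 → w = 0 → v ≠ 0 := by
    rintro w v h0 rfl rfl
    refine h0 (affAlg_ext fun p s => ?_)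
    simp
  have hz : IsInf hπ 0 0 := by
    have h0 : kil 0 0 = 0 := affAlg_ext fun p s => by simp
    rw [IsInf, h0]
    exact Submodule.zero_mem _
  obtain ⟨x, hx, hx0⟩ : ∃ x, IsInf hπ 0 x ∧ x ≠ 0 := by
    obtain ⟨X, hX, hX0⟩ := (symGroup hπ).exists_ne_zero_mem_tangent
      (not_countable_of_exists_translate (hπ := hπ) subset_rfl 0
        (fun p => by
          obtain ⟨g, hg, hgp⟩ := htr 0 p
          exact ⟨g, hg, 0, by rw [zero_smul, add_zero, hgp]⟩) hz)
    obtain ⟨w, v, rfl, hi⟩ := exists_isInf (hπ := hπ) subset_rfl hX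
    obtain rfl := h w v hi
    exact ⟨v, hi, hne hX0 rfl⟩
  have hxx : (inner ℝ x x : ℝ) ≠ 0 := inner_self_ne_zero.2 hx0
  by_cases hy : ∃ y, IsInf hπ 0 y ∧ vcross x y ≠ 0
  · obtain ⟨y, hy, hxy⟩ := hy
    exact isModel_of_two_translations htr hx hy hxy
  exfalso
  push Not at hy
  have hlin : ∀ g ∈ (symGroup hπ).toSubmonoid, ∃ c : ℝ, lin g x = c • x := by
    intro g hg
    obtain ⟨w', v', hi, -, hp⟩ := hx.conj hg
    obtain rfl := h _ _ hi
    have h1 := hp 0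
    rw [vcross_zero_left, vcross_zero_left, zero_add, zero_add] at h1
    rw [h1]
    exact exists_smul_of_cross_eq_zero hx0 (hy _ hi)
  have horth : ∀ g ∈ (symGroup hπ).toSubmonoid, ∀ z, inner ℝ x z = (0 : ℝ) ↔
      inner ℝ x (lin g z) = (0 : ℝ) := by
    intro g hg z
    obtain ⟨c, hc⟩ := hlin g hg
    have hr := isRigid_of_mem hg
    have hc0 : c ≠ 0 := by
      rintro rfl
      exact hr.lin_ne_zero hx0 (by rw [hc, zero_smul])
    rw [← hr.inner_lin, hc, real_inner_smul_left, mul_eq_zero, or_iff_right hc0]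
  have hpt0 : ∀ (g h : AffAlg), IsRigid h → pt (g * h) 0 = pt g 0 + lin g (pt h 0) :=
    fun g h hh => by rw [pt_mul _ hh, ← pt_add, zero_add]
  -- Factoring out the translations along x leaves a group that is still uncountable. Its nonzero
  -- generator is a translation orthogonal to x, whereas all translations are now assumed parallel
  -- to x.
  let G' := (symGroup hπ).cut (fun g => inner ℝ x (pt g 0) = (0 : ℝ))
    (isClosed_eq (continuous_const.inner (continuous_pt 0)) continuous_const)
    (inner_zero_right x)
    (fun g hg h hh h1 h2 => by
      rw [hpt0 _ _ (isRigid_of_mem hh), inner_add_right, h1, zero_add]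
      exact (horth g hg _).1 h2)
    (fun g hg h hh hgh h1 => by
      have e1 := hpt0 g h (isRigid_of_mem hh)
      rw [hgh, pt_one] at e1
      have e2 : (inner ℝ x (lin g (pt h 0)) : ℝ) = 0 := by
        have := congrArg (fun z => (inner ℝ x z : ℝ)) e1
        simp only [inner_add_right, inner_zero_right, h1, zero_add] at this
        exact this.symm
      exact (horth g hg _).2 e2)
  have hsub : G'.carrier ⊆ (symGroup hπ).carrier := Set.inter_subset_left
  have hunc : ¬ G'.carrier.Countable := by
    refine not_countable_of_exists_translate (hπ := hπ) hsub x (fun p => ?_) hx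
    obtain ⟨g, hg, hgp⟩ := htr 0 p
    set r : ℝ := (inner ℝ x x : ℝ)⁻¹ * inner ℝ x (pt g 0) with hr
    have e1 : pt (flow (kil 0 x) (-r) * g) 0 = pt g 0 + (-r) • x := by
      rw [pt_mul _ (isRigid_of_mem hg), flow_kil_zero_pt]
    refine ⟨flow (kil 0 x) (-r) * g, ⟨(symGroup hπ).mul_mem (hx.flow_mem _) hg, ?_⟩, r, ?_⟩
    · simp only [Set.mem_ofPred_eq, e1, inner_add_right, inner_smul_right]
      rw [hr]
      field_simp
      ring
    · rw [e1, add_assoc, ← add_smul, neg_add_cancel, zero_smul, add_zero, hgp]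
  obtain ⟨X, hX, hX0⟩ := G'.exists_ne_zero_mem_tangent hunc
  obtain ⟨w, v, rfl, hi⟩ := exists_isInf hsub hX
  obtain rfl := h w v hi
  have hv0 := hne hX0 rfl
  have hv : inner ℝ x v = (0 : ℝ) := by
    have := apply_mem_of_flow_mem (fstEval (0, 1)) (LinearMap.ker (innerSL ℝ x).toLinearMap)
      (X := kil 0 v) fun t => by
        have e : (1 : AffAlg) ((0, 1) : E3 × ℝ) = (0, 1) := rfl
        rw [fstEval_apply, fstEval_apply, e, sub_zero, LinearMap.mem_ker]
        exact (ClosedLinearGroup.mem_tangent.1 hX t).2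
    simpa using this
  obtain ⟨c, rfl⟩ := exists_smul_of_cross_eq_zero hx0 (hy v hi)
  rw [inner_smul_right] at hv
  rw [(mul_eq_zero.1 hv).resolve_right hxx, zero_smul] at hv0
  exact hv0 rfl

theorem isModel_of_transitive
    (htr : ∀ p q, ∃ g ∈ (symGroup hπ).toSubmonoid, π (pt g p) = π q) : IsModel π := by
  by_cases hw : ∃ w v, IsInf hπ w v ∧ w ≠ 0
  · obtain ⟨w, v, h, hw⟩ := hw
    by_cases hpar : ∀ w' v', IsInf hπ w' v' → vcross w w' = 0
    · exact isModel_of_parallel_rotations htr h hw hpar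
    · push Not at hpar
      obtain ⟨w', v', h', hww'⟩ := hpar
      exact isModel_of_nonparallel_rotations h h' hww'
  · push Not at hw
    exact isModel_of_only_translations htr hw

end Cases

/-! ### The lines of the model and their images under isometries -/

section Models

open Filter Topology

/-- The line through `p` in the direction `v`. -/
def lineThrough (p v : E3) : Set E3 := Set.range fun s : ℝ => p + s • v

@[simp] theorem fieldV_apply_zero (t : ℝ) (p : E3) : fieldV t p 0 = Real.cos (t * p 2) := rfl
@[simp] theorem fieldV_apply_one (t : ℝ) (p : E3) : fieldV t p 1 = Real.sin (t * p 2) := rfl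
@[simp] theorem fieldV_apply_two (t : ℝ) (p : E3) : fieldV t p 2 = 0 := rfl

theorem fieldV_ne_zero (t : ℝ) (p : E3) : fieldV t p ≠ 0 := by
  intro h
  have h0 := congrArg (· 0) h
  have h1 := congrArg (· 1) h
  simp at h0 h1
  have := Real.sin_sq_add_cos_sq (t * p 2)
  rw [h0, h1] at this
  norm_num at this

theorem fieldV_add_smul (t s : ℝ) (p : E3) : fieldV t (p + s • fieldV t p) = fieldV t p := by
  apply E3.ext_coord <;> simp

theorem mem_lineThrough_self (p v : E3) : p ∈ lineThrough p v := ⟨0, by simp⟩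

theorem lineThrough_fieldV_eq {t : ℝ} {p q : E3} (h : q ∈ lineThrough p (fieldV t p)) :
    lineThrough q (fieldV t q) = lineThrough p (fieldV t p) := by
  obtain ⟨r, rfl⟩ := h
  simp only
  rw [fieldV_add_smul]
  ext x
  constructor
  · rintro ⟨s, rfl⟩
    exact ⟨r + s, by simp only; rw [add_smul, add_assoc]⟩
  · rintro ⟨s, rfl⟩
    refine ⟨s - r, ?_⟩
    simp only
    rw [sub_smul]
    abel

/-- The height z is constant along an integral curve, hence so is the field, and the curve is a
straight line. -/
theorem mem_fibrationF {t : ℝ} {l : Set E3} :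
    l ∈ fibrationF t ↔ ∃ p, l = lineThrough p (fieldV t p) := by
  constructor
  · rintro ⟨γ, hγ, rfl⟩
    refine ⟨γ 0, congrArg Set.range (funext fun s => ?_)⟩
    have hcoord : ∀ i s, HasDerivAt (fun s => γ s i) (fieldV t (γ s) i) s := fun i s =>
      (EuclideanSpace.proj (𝕜 := ℝ) i : E3 →L[ℝ] ℝ).hasFDerivAt.comp_hasDerivAt s (hγ s)
    have h2 : ∀ s, γ s 2 = γ 0 2 := fun s =>
      is_const_of_deriv_eq_zero (fun s => (hcoord 2 s).differentiableAt)
        (fun s => (hcoord 2 s).deriv) s 0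
    have hf : ∀ s, fieldV t (γ s) = fieldV t (γ 0) := fun s => by
      apply E3.ext_coord <;> simp [h2 s]
    have hd : ∀ s, HasDerivAt (fun s => γ s - s • fieldV t (γ 0)) 0 s := fun s => by
      have h1 : HasDerivAt γ (fieldV t (γ s)) s := hγ s
      have h3 := h1.sub ((hasDerivAt_id s).smul_const (fieldV t (γ 0)))
      rw [one_smul, hf s, sub_self] at h3
      exact h3
    have hc := is_const_of_deriv_eq_zero (fun s => (hd s).differentiableAt)
      (fun s => (hd s).deriv) s 0
    simp only [zero_smul, sub_zero] at hc
    exact sub_eq_iff_eq_add.1 hc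
  · rintro ⟨p, rfl⟩
    refine ⟨fun s => p + s • fieldV t p, fun s => ?_, rfl⟩
    simp only
    rw [fieldV_add_smul]
    simpa using ((hasDerivAt_id s).smul_const (fieldV t p)).const_add p

theorem isometryEquiv_image_lineThrough (L : E3 ≃ₗᵢ[ℝ] E3) (T : E3 ≃ᵢ E3) {p : E3}
    (hT : ∀ x, T x = L (x - p) + T p) (q v : E3) :
    T '' lineThrough q v = lineThrough (T q) (L v) := by
  rw [lineThrough, lineThrough, ← Set.range_comp]
  refine congrArg Set.range (funext fun s => ?_)
  simp only [Function.comp_apply]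
  rw [hT (q + s • v), hT q, ← map_smul, add_sub_right_comm, map_add]
  abel

/-- The rigid motion in `AffAlg` defined by an isometry. -/
theorem exists_isRigid_of_isometryEquiv (T : E3 ≃ᵢ E3) :
    ∃ g : AffAlg, IsRigid g ∧ ∀ x, pt g x = T x := by
  let A := T.toRealAffineIsometryEquiv
  let L := A.linearIsometryEquiv
  let g : AffAlg := (L.toContinuousLinearEquiv.toContinuousLinearMap.comp
    (ContinuousLinearMap.fst ℝ E3 ℝ) + (ContinuousLinearMap.snd ℝ E3 ℝ).smulRight (T 0)).prod
    (ContinuousLinearMap.snd ℝ E3 ℝ)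
  have happ : ∀ v s, g (v, s) = (L v + s • T 0, s) := fun v s => rfl
  refine ⟨g, ⟨fun x => rfl, fun v => ?_⟩, fun x => ?_⟩
  · simp [lin, happ]
  · have h1 : T x = A x := rfl
    have h2 : A (x +ᵥ (0 : E3)) = L x +ᵥ A 0 := A.map_vadd 0 x
    have h3 : A 0 = T 0 := rfl
    simp only [pt, happ, one_smul]
    rw [h1, ← h3]
    simpa using h2.symm

theorem image_lineThrough_of_isRigid {g : AffAlg} {T : E3 ≃ᵢ E3} (hT : ∀ x, pt g x = T x)
    (q v : E3) : T '' lineThrough q v = lineThrough (T q) (lin g v) := by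
  rw [lineThrough, lineThrough, ← Set.range_comp]
  refine congrArg Set.range (funext fun s => ?_)
  simp only [Function.comp_apply]
  rw [← hT, ← hT, pt_add, lin_smul]

end Models

/-! ### Inequivalence of the models -/

section Uniqueness

theorem FibrationEquivalent.symm {F₁ F₂ : Set (Set E3)} (h : FibrationEquivalent F₁ F₂) :
    FibrationEquivalent F₂ F₁ := by
  obtain ⟨T, rfl⟩ := h
  refine ⟨T.symm, ?_⟩
  rw [Set.image_image]
  simp [Set.image_image]

theorem le_of_fibrationEquivalent {t t' : ℝ} (ht : 0 < t) (ht' : 0 ≤ t')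
    (h : FibrationEquivalent (fibrationF t) (fibrationF t')) : t ≤ t' := by
  obtain ⟨T, hT⟩ := h
  obtain ⟨g, hg, hgT⟩ := exists_isRigid_of_isometryEquiv T
  have hdir : ∀ x, ∃ c : ℝ, lin g (fieldV t x) = c • fieldV t' (T x) := by
    intro x
    have h1 : T '' lineThrough x (fieldV t x) ∈ fibrationF t' := by
      rw [hT]
      exact ⟨_, mem_fibrationF.2 ⟨x, rfl⟩, rfl⟩
    obtain ⟨y, hy⟩ := mem_fibrationF.1 h1
    rw [image_lineThrough_of_isRigid hgT] at hy
    have h2 : T x ∈ lineThrough y (fieldV t' y) := hy ▸ mem_lineThrough_self _ _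
    rw [← lineThrough_fieldV_eq h2] at hy
    have h3 : T x + lin g (fieldV t x) ∈ lineThrough (T x) (fieldV t' (T x)) := by
      rw [← hy]
      exact ⟨1, by simp⟩
    obtain ⟨c, hc⟩ := h3
    exact ⟨c, (add_left_cancel hc).symm⟩
  by_contra! hlt
  -- At this height difference the fibers of the first model are perpendicular. The isometry
  -- preserves the height difference up to sign, and t' < t would leave an angle t' * z below π / 2.
  set z : ℝ := Real.pi / (2 * t)
  have htz : t * z = Real.pi / 2 := by simp only [z]; field_simp
  set e3 : E3 := EuclideanSpace.single 2 1
  set a := fieldV t 0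
  set b := fieldV t (z • e3)
  obtain ⟨ca, hca⟩ := hdir 0
  obtain ⟨cb, hcb⟩ := hdir (z • e3)
  have ea : a = !₂[1, 0, 0] := by
    apply E3.ext_coord <;> simp [a]
  have eb : b = !₂[0, 1, 0] := by
    apply E3.ext_coord <;> simp [b, e3, htz]
  have hab : inner ℝ (lin g a) (lin g b) = (0 : ℝ) := by
    rw [hg.inner_lin, E3.inner_eq, ea, eb]; simp
  have haa : inner ℝ (lin g a) (lin g a) = (1 : ℝ) := by
    rw [hg.inner_lin, E3.inner_eq, ea]; simp
  have hbb : inner ℝ (lin g b) (lin g b) = (1 : ℝ) := by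
    rw [hg.inner_lin, E3.inner_eq, eb]; simp
  have ha3 : inner ℝ (lin g e3) (lin g a) = (0 : ℝ) := by
    rw [hg.inner_lin, E3.inner_eq, ea]; simp [e3]
  have hb3 : inner ℝ (lin g e3) (lin g b) = (0 : ℝ) := by
    rw [hg.inner_lin, E3.inner_eq, eb]; simp [e3]
  have h33 : inner ℝ (lin g e3) (lin g e3) = (1 : ℝ) := by
    rw [hg.inner_lin, E3.inner_eq]; simp [e3]
  have ha2 : lin g a 2 = 0 := by rw [hca]; simp
  have hb2 : lin g b 2 = 0 := by rw [hcb]; simp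
  have hne : vcross (lin g a) (lin g b) ≠ 0 := by
    intro h0
    have h1 := vcross_cross_right (lin g a) (lin g a) (lin g b)
    rw [h0, vcross_zero_right, hab, haa, zero_smul, one_smul, zero_sub, eq_comm, neg_eq_zero] at h1
    rw [h1, inner_zero_left] at hbb
    exact zero_ne_one hbb
  obtain ⟨k, hk⟩ := exists_smul_of_cross_eq_zero hne (b := lin g e3) (by
    rw [vcross_anticomm, vcross_cross_right, ha3, hb3, zero_smul, zero_smul, sub_zero, neg_zero])
  have h30 : lin g e3 0 = 0 := by rw [hk]; simp [ha2, hb2]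
  have h31 : lin g e3 1 = 0 := by rw [hk]; simp [ha2, hb2]
  have h32 : lin g e3 2 = 1 ∨ lin g e3 2 = -1 := by
    rw [E3.inner_eq, h30, h31] at h33
    exact mul_self_eq_one_iff.1 (by linarith)
  have hTz : T (z • e3) 2 = T 0 2 + z * lin g e3 2 := by
    rw [← hgT, ← hgT, ← zero_add (z • e3), pt_add, lin_smul]
    simp
  have hcos : inner ℝ (fieldV t' (T 0)) (fieldV t' (T (z • e3))) = Real.cos (t' * z) := by
    rw [E3.inner_eq]
    simp only [fieldV_apply_zero, fieldV_apply_one, fieldV_apply_two, mul_zero, add_zero]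
    rw [← Real.cos_sub, hTz]
    rcases h32 with h | h <;> rw [h]
    · rw [← Real.cos_neg]; ring_nf
    · ring_nf
  have hpos : 0 < Real.cos (t' * z) := by
    have hz : 0 < z := by positivity
    refine Real.cos_pos_of_mem_Ioo ⟨?_, ?_⟩
    · have := mul_nonneg ht' hz.le
      linarith [Real.pi_pos]
    · rw [← htz]
      exact mul_lt_mul_of_pos_right hlt hz
  rw [hca, hcb, real_inner_smul_left, inner_smul_right, hcos] at hab
  have hca0 : ca ≠ 0 := by
    rintro rfl
    rw [hca, zero_smul, inner_zero_left] at haa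
    exact zero_ne_one haa
  have hcb0 : cb ≠ 0 := by
    rintro rfl
    rw [hcb, zero_smul, inner_zero_left] at hbb
    exact zero_ne_one hbb
  exact (mul_ne_zero hca0 (mul_ne_zero hcb0 hpos.ne')) hab

theorem eq_of_fibrationEquivalent {t t' : ℝ} (ht : 0 ≤ t) (ht' : 0 ≤ t')
    (h : FibrationEquivalent (fibrationF t) (fibrationF t')) : t = t' := by
  have h1 : t ≤ t' := by
    rcases ht.eq_or_lt with rfl | h0
    · exact ht'
    · exact le_of_fibrationEquivalent h0 ht' h
  have h2 : t' ≤ t := by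
    rcases ht'.eq_or_lt with rfl | h0
    · exact ht
    · exact le_of_fibrationEquivalent h0 ht h.symm
  exact le_antisymm h1 h2

end Uniqueness

/-! ### From a homogeneous fibration to a model -/

section Reduction

theorem isLineMap_of_fibers {B : Type*} [TopologicalSpace B] {π : E3 → B} (hc : Continuous π)
    (hl : ∀ b, IsStraightLine (π ⁻¹' {b})) : IsLineMap π := by
  refine ⟨hc, fun p => ?_⟩
  obtain ⟨a, v, hv, h⟩ := hl (π p)
  have hmem : ∀ q, π q = π p ↔ ∃ s : ℝ, a + s • v = q := fun q => by
    change q ∈ π ⁻¹' {π p} ↔ _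
    rw [h]
    rfl
  obtain ⟨s₀, hs₀⟩ := (hmem p).1 rfl
  have hv0 : ‖v‖ ≠ 0 := norm_ne_zero_iff.2 hv
  refine ⟨‖v‖⁻¹ • v, norm_smul_inv_norm hv, fun q => (hmem q).trans ⟨?_, ?_⟩⟩
  · rintro ⟨s, rfl⟩
    refine ⟨(s - s₀) * ‖v‖, ?_⟩
    rw [smul_smul, mul_inv_cancel_right₀ hv0, ← hs₀]
    module
  · rintro ⟨s, rfl⟩
    refine ⟨s₀ + s * ‖v‖⁻¹, ?_⟩
    rw [← hs₀]
    module

theorem symGroup_transitive {B : Type*} [TopologicalSpace B] [T2Space B] {π : E3 → B}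
    (hπ : IsLineMap π) (hF : FiberwiseHomogeneous (Set.range fun b : B => π ⁻¹' {b})) (p q : E3) :
    ∃ g ∈ (symGroup hπ).toSubmonoid, π (pt g p) = π q := by
  obtain ⟨T, hT, hpq⟩ := hF _ ⟨π p, rfl⟩ _ ⟨π q, rfl⟩
  obtain ⟨g, hg, hgT⟩ := exists_isRigid_of_isometryEquiv T
  refine ⟨g, ⟨hg, fun x y hxy => ?_⟩, ?_⟩
  · obtain ⟨b, hb⟩ := hT _ ⟨π x, rfl⟩
    have h1 : T x ∈ π ⁻¹' {b} := by
      simp only at hb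
      rw [hb]
      exact ⟨x, rfl, rfl⟩
    have h2 : T y ∈ π ⁻¹' {b} := by
      simp only at hb
      rw [hb]
      exact ⟨y, hxy.symm, rfl⟩
    rw [hgT, hgT]
    exact (show π (T x) = b from h1).trans (show π (T y) = b from h2).symm
  · have : T p ∈ π ⁻¹' {π q} := by
      simp only at hpq
      rw [← hpq]
      exact ⟨p, rfl, rfl⟩
    rw [hgT]
    exact this

/-- The isometry sends the standard basis to u, f, n. The frame may have either orientation, which
is what allows the sign of t to be changed. -/
theorem equivalent_of_frame {B : Type*} [TopologicalSpace B] {π : E3 → B} (hπ : IsLineMap π)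
    (hsurj : Function.Surjective π) {t : ℝ} {u f n : E3} (hu : ‖u‖ = 1) (hf : ‖f‖ = 1)
    (hn : ‖n‖ = 1) (huf : inner ℝ u f = (0 : ℝ)) (hun : inner ℝ u n = (0 : ℝ))
    (hfn : inner ℝ f n = (0 : ℝ))
    (hd : ∀ p, IsDir π p (Real.cos (t * inner ℝ n p) • u + Real.sin (t * inner ℝ n p) • f)) :
    FibrationEquivalent (fibrationF t) (Set.range fun b : B => π ⁻¹' {b}) := by
  have hfu : inner ℝ f u = (0 : ℝ) := by rw [real_inner_comm, huf]
  have hnu : inner ℝ n u = (0 : ℝ) := by rw [real_inner_comm, hun]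
  have hnf : inner ℝ n f = (0 : ℝ) := by rw [real_inner_comm, hfn]
  have huu : inner ℝ u u = (1 : ℝ) := by rw [real_inner_self_eq_norm_sq, hu, one_pow]
  have hff : inner ℝ f f = (1 : ℝ) := by rw [real_inner_self_eq_norm_sq, hf, one_pow]
  have hnn : inner ℝ n n = (1 : ℝ) := by rw [real_inner_self_eq_norm_sq, hn, one_pow]
  let L₀ : E3 →ₗᵢ[ℝ] E3 :=
    { toFun := fun x => x 0 • u + x 1 • f + x 2 • n
      map_add' := fun x y => by simp only [PiLp.add_apply]; module
      map_smul' := fun c x => by simp only [PiLp.smul_apply, smul_eq_mul, RingHom.id_apply]; module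
      norm_map' := fun x => by
        have h1 : inner ℝ (x 0 • u + x 1 • f + x 2 • n) (x 0 • u + x 1 • f + x 2 • n) =
            (inner ℝ x x : ℝ) := by
          simp only [inner_add_left, inner_add_right, real_inner_smul_left, inner_smul_right, huf,
            hun, hfn, hfu, hnu, hnf, huu, hff, hnn]
          rw [E3.inner_eq]
          ring
        rw [real_inner_self_eq_norm_sq, real_inner_self_eq_norm_sq] at h1
        exact (pow_left_inj₀ (norm_nonneg _) (norm_nonneg _) two_ne_zero).1 h1 }
  let L := L₀.toLinearIsometryEquiv rfl
  have hL : ∀ x, L x = x 0 • u + x 1 • f + x 2 • n := fun x => rfl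
  have hLn : ∀ x, inner ℝ n (L x) = x 2 := fun x => by
    rw [hL]
    simp only [inner_add_right, inner_smul_right, hnu, hnf, hnn]
    ring
  have hLV : ∀ x, IsDir π (L x) (L (fieldV t x)) := fun x => by
    have h1 := hd (L x)
    rw [hLn] at h1
    have h2 : L (fieldV t x) = Real.cos (t * x 2) • u + Real.sin (t * x 2) • f := by
      rw [hL]
      simp
    rwa [h2]
  have himg : ∀ x, L.toIsometryEquiv '' lineThrough x (fieldV t x) = π ⁻¹' {π (L x)} := fun x => by
    rw [isometryEquiv_image_lineThrough L L.toIsometryEquiv (p := 0) (fun y => by simp)]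
    have hne : L (fieldV t x) ≠ 0 := by
      rw [Ne, LinearIsometryEquiv.map_eq_zero_iff]
      exact fieldV_ne_zero t x
    ext y
    constructor
    · rintro ⟨s, rfl⟩
      exact hLV x s
    · intro hy
      obtain ⟨s, rfl⟩ := hπ.exists_eq_add hne (hLV x) hy
      exact ⟨s, rfl⟩
  refine ⟨L.toIsometryEquiv, Set.ext fun l => ⟨?_, ?_⟩⟩
  · rintro ⟨b, rfl⟩
    obtain ⟨p, rfl⟩ := hsurj b
    obtain ⟨x, rfl⟩ := L.surjective p
    exact ⟨_, mem_fibrationF.2 ⟨x, rfl⟩, himg x⟩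
  · rintro ⟨m, hm, rfl⟩
    obtain ⟨x, rfl⟩ := mem_fibrationF.1 hm
    exact ⟨π (L x), (himg x).symm⟩

theorem IsModel.exists_equivalent {B : Type*} [TopologicalSpace B] {π : E3 → B}
    (hπ : IsLineMap π) (hsurj : Function.Surjective π) (h : IsModel π) :
    ∃ t : ℝ, 0 ≤ t ∧ FibrationEquivalent (fibrationF t) (Set.range fun b : B => π ⁻¹' {b}) := by
  obtain ⟨t, u, n, hu, hn, hnu, hd⟩ := h
  have hun : inner ℝ u n = (0 : ℝ) := by rw [real_inner_comm, hnu]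
  have huf : inner ℝ u (vcross n u) = (0 : ℝ) := inner_cross_right n u
  have hfn : inner ℝ (vcross n u) n = (0 : ℝ) := by rw [real_inner_comm, inner_cross_left]
  have hf : ‖vcross n u‖ = 1 := by
    have h1 : inner ℝ (vcross n u) (vcross n u) =
        (inner ℝ n n * inner ℝ u u - (inner ℝ n u) ^ 2 : ℝ) := by
      simp only [E3.inner_eq, vcross_apply_zero, vcross_apply_one, vcross_apply_two]
      ring
    rw [hnu, real_inner_self_eq_norm_sq, real_inner_self_eq_norm_sq, real_inner_self_eq_norm_sq,
      hu, hn] at h1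
    exact (pow_left_inj₀ (norm_nonneg _) zero_le_one two_ne_zero).1 (by linarith)
  rcases le_total 0 t with ht | ht
  · exact ⟨t, ht, equivalent_of_frame hπ hsurj hu hf hn huf hun hfn hd⟩
  -- Reversing the second frame vector is a reflection that replaces t by -t.
  · refine ⟨-t, neg_nonneg.2 ht, equivalent_of_frame hπ hsurj (f := -vcross n u) hu
      (by rw [norm_neg, hf]) hn (by rw [inner_neg_right, huf, neg_zero]) hun
      (by rw [inner_neg_left, hfn, neg_zero]) fun p => ?_⟩
    rw [neg_mul, Real.cos_neg, Real.sin_neg, neg_smul_neg]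
    exact hd p

theorem exists_equivalent_fibrationF {r : WithTop ℕ∞} {F : Set (Set E3)}
    (hF : IsFibrationByLines r F) (hhom : FiberwiseHomogeneous F) :
    ∃ t : ℝ, 0 ≤ t ∧ FibrationEquivalent (fibrationF t) F := by
  obtain ⟨⟨B, _, _, _, _, _, π, hπ, -, rfl⟩, hlines⟩ := hF
  have hl : ∀ b, IsStraightLine (π ⁻¹' {b}) := fun b => hlines _ ⟨b, rfl⟩
  have hlm := isLineMap_of_fibers hπ.continuous hl
  have hsurj : Function.Surjective π := fun b => by
    obtain ⟨p, v, -, h⟩ := hl b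
    have : p ∈ π ⁻¹' {b} := h ▸ ⟨0, by simp⟩
    exact ⟨p, this⟩
  exact (isModel_of_transitive (symGroup_transitive hlm hhom)).exists_equivalent hlm hsurj

end Reduction

/-! ### The models are homogeneous fibrations -/

section Existence

/-- The rotation by the angle `θ` about the `z`-axis. -/
noncomputable def rotZ (θ : ℝ) : E3 →ₗᵢ[ℝ] E3 where
  toFun x := !₂[Real.cos θ * x 0 - Real.sin θ * x 1, Real.sin θ * x 0 + Real.cos θ * x 1, x 2]
  map_add' x y := by apply E3.ext_coord <;> simp <;> ring
  map_smul' c x := by apply E3.ext_coord <;> simp <;> ring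
  norm_map' x := by
    have h1 : ∀ y : E3, inner ℝ y y = (inner ℝ x x : ℝ) → ‖y‖ = ‖x‖ := fun y h => by
      rw [real_inner_self_eq_norm_sq, real_inner_self_eq_norm_sq] at h
      exact (pow_left_inj₀ (norm_nonneg _) (norm_nonneg _) two_ne_zero).1 h
    refine h1 _ ?_
    simp only [E3.inner_eq, LinearMap.coe_mk, AddHom.coe_mk]
    simp
    linear_combination (x 0 ^ 2 + x 1 ^ 2) * Real.sin_sq_add_cos_sq θ

/-- The motion taking p to q turns about the vertical by t (q 2 - p 2), exactly the turn of the
field between the two heights. -/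
theorem fiberwiseHomogeneous_fibrationF (t : ℝ) : FiberwiseHomogeneous (fibrationF t) := by
  intro l₁ h₁ l₂ h₂
  obtain ⟨p, rfl⟩ := mem_fibrationF.1 h₁
  obtain ⟨q, rfl⟩ := mem_fibrationF.1 h₂
  let L : E3 ≃ₗᵢ[ℝ] E3 := (rotZ (t * (q 2 - p 2))).toLinearIsometryEquiv rfl
  let T : E3 ≃ᵢ E3 :=
    ((IsometryEquiv.subRight p).trans L.toIsometryEquiv).trans (IsometryEquiv.addRight q)
  have hT : ∀ x, T x = L (x - p) + q := fun x => rfl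
  have hTp : T p = q := by rw [hT, sub_self, map_zero, zero_add]
  have hV : ∀ x, L (fieldV t x) = fieldV t (T x) := fun x => by
    have h2 : t * (T x) 2 = t * (q 2 - p 2) + t * x 2 := by
      have : (T x) 2 = x 2 - p 2 + q 2 := rfl
      rw [this]
      ring
    apply E3.ext_coord
    · rw [fieldV_apply_zero, h2, Real.cos_add]
      rfl
    · rw [fieldV_apply_one, h2, Real.sin_add]
      rfl
    · rfl
  have himg : ∀ x, T '' lineThrough x (fieldV t x) = lineThrough (T x) (fieldV t (T x)) := fun x => by
    rw [isometryEquiv_image_lineThrough L T (p := p) (fun y => by rw [hTp, hT]), hV]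
  refine ⟨T, fun l hl => ?_, ?_⟩
  · obtain ⟨x, rfl⟩ := mem_fibrationF.1 hl
    exact mem_fibrationF.2 ⟨T x, himg x⟩
  · rw [himg, hTp]

/-- The projection whose fibers are the lines of `fibrationF t`. -/
noncomputable def projF (t : ℝ) (p : E3) : EuclideanSpace ℝ (Fin 2) :=
  !₂[-Real.sin (t * p 2) * p 0 + Real.cos (t * p 2) * p 1, p 2]

/-- The coordinate along the lines of `fibrationF t`. -/
noncomputable def coordF (t : ℝ) (p : E3) : ℝ :=
  Real.cos (t * p 2) * p 0 + Real.sin (t * p 2) * p 1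

/-- The inverse of `projF` and `coordF` taken together. -/
noncomputable def invF (t : ℝ) (x : EuclideanSpace ℝ (Fin 2) × ℝ) : E3 :=
  !₂[Real.cos (t * x.1 1) * x.2 - Real.sin (t * x.1 1) * x.1 0,
    Real.sin (t * x.1 1) * x.2 + Real.cos (t * x.1 1) * x.1 0, x.1 1]

theorem invF_projF (t : ℝ) (p : E3) : invF t (projF t p, coordF t p) = p := by
  apply E3.ext_coord
  · simp [invF, projF, coordF]
    linear_combination (p 0) * Real.sin_sq_add_cos_sq (t * p 2)
  · simp [invF, projF, coordF]
    linear_combination (p 1) * Real.sin_sq_add_cos_sq (t * p 2)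
  · simp [invF, projF]

theorem projF_invF (t : ℝ) (x : EuclideanSpace ℝ (Fin 2) × ℝ) : projF t (invF t x) = x.1 := by
  ext i
  fin_cases i
  · simp [invF, projF]
    linear_combination (x.1 0) * Real.sin_sq_add_cos_sq (t * x.1 1)
  · simp [invF, projF]

theorem coordF_invF (t : ℝ) (x : EuclideanSpace ℝ (Fin 2) × ℝ) : coordF t (invF t x) = x.2 := by
  simp [invF, coordF]
  linear_combination (x.2) * Real.sin_sq_add_cos_sq (t * x.1 1)

theorem contDiff_projF (t : ℝ) {r : WithTop ℕ∞} : ContDiff ℝ r (projF t) := by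
  rw [contDiff_euclidean]
  intro i
  fin_cases i
  · simp [projF]; fun_prop
  · simp [projF]; fun_prop

theorem contDiff_coordF (t : ℝ) {r : WithTop ℕ∞} : ContDiff ℝ r (coordF t) := by
  unfold coordF
  fun_prop

theorem contDiff_invF (t : ℝ) {r : WithTop ℕ∞} : ContDiff ℝ r (invF t) := by
  rw [contDiff_euclidean]
  intro i
  fin_cases i
  · simp [invF]; fun_prop
  · simp [invF]; fun_prop
  · simp [invF]; fun_prop

theorem projF_fiber (t : ℝ) (b : EuclideanSpace ℝ (Fin 2)) :
    projF t ⁻¹' {b} = lineThrough (invF t (b, 0)) (fieldV t (invF t (b, 0))) := by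
  have hline : ∀ s : ℝ, invF t (b, 0) + s • fieldV t (invF t (b, 0)) = invF t (b, s) := fun s => by
    apply E3.ext_coord <;> simp [invF] <;> ring
  ext p
  constructor
  · rintro rfl
    refine ⟨coordF t p, ?_⟩
    simp only
    rw [hline, invF_projF]
  · rintro ⟨s, rfl⟩
    simp only
    rw [hline]
    exact projF_invF t (b, s)

/-- The global trivialization of `projF t`. -/
noncomputable def trivF (t : ℝ) : Bundle.Trivialization ℝ (projF t) where
  toFun p := (projF t p, coordF t p)
  invFun := invF t
  source := Set.univ
  target := Set.univ
  map_source' _ _ := Set.mem_univ _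
  map_target' _ _ := Set.mem_univ _
  left_inv' p _ := invF_projF t p
  right_inv' x _ := Prod.ext (projF_invF t x) (coordF_invF t x)
  open_source := isOpen_univ
  open_target := isOpen_univ
  continuousOn_toFun :=
    ((contDiff_projF t (r := 0)).continuous.prodMk (contDiff_coordF t (r := 0)).continuous).continuousOn
  continuousOn_invFun := (contDiff_invF t (r := 0)).continuous.continuousOn
  baseSet := Set.univ
  open_baseSet := isOpen_univ
  source_eq := by simp
  target_eq := by simp
  proj_toFun _ _ := rfl

theorem isFibrationByLines_fibrationF (r : WithTop ℕ∞) (t : ℝ) :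
    IsFibrationByLines r (fibrationF t) := by
  refine ⟨⟨EuclideanSpace ℝ (Fin 2), inferInstance, inferInstance, inferInstance, inferInstance,
    inferInstance, projF t, (contDiff_projF t).contMDiff, fun b => ⟨trivF t, Set.mem_univ _, ?_, ?_⟩,
    ?_⟩, fun l hl => ?_⟩
  · exact ((contDiff_projF t).contMDiff.prodMk (contDiff_coordF t).contMDiff).contMDiffOn
  · have h : ContMDiff ((𝓡 2).prod 𝓘(ℝ, ℝ)) 𝓘(ℝ, E3) r (invF t) := by
      rw [← modelWithCornersSelf_prod, chartedSpaceSelf_prod]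
      exact (contDiff_invF t).contMDiff
    exact h.contMDiffOn
  · ext l
    rw [mem_fibrationF]
    constructor
    · rintro ⟨p, rfl⟩
      refine ⟨projF t p, ?_⟩
      simp only
      rw [projF_fiber]
      refine (lineThrough_fieldV_eq ?_).symm
      rw [← projF_fiber]
      rfl
    · rintro ⟨b, rfl⟩
      exact ⟨_, projF_fiber t b⟩
  · obtain ⟨p, rfl⟩ := mem_fibrationF.1 hl
    exact ⟨p, fieldV t p, fieldV_ne_zero t p, rfl⟩

end Existence

theorem theorem3p1 (r : WithTop ℕ∞) :
    (∀ t : ℝ, 0 ≤ t → IsFibrationByLines r (fibrationF t) ∧ FiberwiseHomogeneous (fibrationF t)) ∧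
    (∀ 𝓕 : Set (Set E3), IsFibrationByLines r 𝓕 → FiberwiseHomogeneous 𝓕 →
      ∃ t : ℝ, 0 ≤ t ∧ FibrationEquivalent (fibrationF t) 𝓕) ∧
    (∀ t t' : ℝ, 0 ≤ t → 0 ≤ t' → FibrationEquivalent (fibrationF t) (fibrationF t') → t = t') :=
  ⟨fun t _ => ⟨isFibrationByLines_fibrationF r t, fiberwiseHomogeneous_fibrationF t⟩,
    fun _ hF hhom => exists_equivalent_fibrationF hF hhom,
    fun _ _ ht ht' h => eq_of_fibrationEquivalent ht ht' h⟩
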